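/- A dataset is a finite list $X=(x_1,\dots,x_n)$ of points of a set $\mathcal X$; two datasets are adjacent if, up to order, one arises from the other by adding one point. A randomized algorithm $\mathcal M$ satisfies $(\alpha,\epsilon)$-RDP if $\mathsf D_\alpha(\mathbb P_{\mathcal M(X)}\|\mathbb P_{\mathcal M(X')})\le\epsilon$ for all adjacent $X,X'$, where $\mathsf D_\alpha(\mathsf P\|\mathsf Q)=\frac1{\alpha-1}\log\int(\frac{d\mathsf P}{d\mathsf Q})^\alpha\,d\mathsf Q$ is the Rényi divergence. Given $F:\mathcal X\to\mathbb R^d$, a clipping map $\mathcal{CP}:\mathbb R^d\to\mathbb R^d$, rates $q_1,q_2\in[0,1]$ and $\sigma>0$, *$(q_1,q_2)$-twice sampling* first selects a random set $I\subseteq\{1,\dots,n\}$ containing each index independently with probability $q_1$; then, independently for each coordinate $l=1,\dots,d$, it selects a random subset $J_l\subseteq I$ containing each index of $I$ independently with probability $q_2$, and outputs $o_l=\sum_{i\in J_l}\mathcal{CP}(F(x_i))(l)+\mathcal N(0,\sigma^2)$ with independent noises. Let $\alpha\ge2$ be an integer, $p\in(0,2]$, $c_p>0$, $\sigma>0$,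 $\tau=(c_p/(\sqrt2\,\sigma))^2$, and $$\epsilon(\alpha)=\frac1{\alpha-1}\log\Big((1-q_1)^\alpha+\sum_{v=1}^{\alpha}\binom{\alpha}{v}(1-q_1)^{\alpha-v}q_1^v\,e^{v(v-1)q_2^2\tau}\Big).$$ (i) For all $q_1,q_2\in[0,1]$ and every $\eta>0$ there is $N$ such that for all integers $d\ge d_0\ge N$, with $c_\infty>0$ given by $d_0c_\infty^p=c_p^p$, for every $\mathcal X$, every $F:\mathcal X\to\mathbb R^d$ and every clipping map $\mathcal{CP}$ with values in $\{s\in\mathbb R^d:\|s\|_p\le c_p,\ \|s\|_\infty\le c_\infty\}$, $(q_1,q_2)$-twice sampling satisfies $(\alpha,\epsilon(\alpha)+\eta)$-RDP. If $p<2$, this holds with $\eta=0$ as well. (ii) There is an absolute constant $C>0$ such that for every integer $\alpha\ge2$ and every $\tau>0$ there is $q_0>0$ with $\epsilon(\alpha)\le C\,\alpha\,(q_1q_2)^2\,\tau$ for all $q_1,q_2\in(0,q_0]$. -/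

import Mathlib

open MeasureTheory ProbabilityTheory

open scoped ENNReal

universe u

noncomputable section

namespace TwiceSampling

/-- The Rényi divergence of order `α > 1`,
`D_α(P ‖ Q) = (α - 1)⁻¹ log ∫ (dP/dQ)^α dQ`, with the usual value `∞` if `P` is not absolutely
continuous with respect to `Q`. -/
def renyiDiv {Ω : Type*} [MeasurableSpace Ω] (α : ℝ) (P Q : Measure Ω) : EReal :=
  open Classical in
  if P ≪ Q then (((α - 1)⁻¹ : ℝ) : EReal) * ENNReal.log (∫⁻ x, (P.rnDeriv Q x) ^ α ∂Q) else ⊤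

/-- Two datasets are adjacent if one of them arises from the other by adding one datapoint
(the order in which the datapoints are listed is irrelevant). -/
def Adjacent {𝒳 : Type*} (X X' : List 𝒳) : Prop :=
  ∃ x : 𝒳, X'.Perm (x :: X) ∨ X.Perm (x :: X')

/-- `(α, ε)`-Rényi differential privacy of a randomized algorithm `M`, which is given by the law
`M X` of its output on every dataset `X`. -/
def IsRDP {𝒳 Ω : Type*} [MeasurableSpace Ω] (M : List 𝒳 → Measure Ω) (α ε : ℝ) : Prop :=
  ∀ X X' : List 𝒳, Adjacent X X' → renyiDiv α (M X) (M X') ≤ (ε : EReal)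

/-- The sensitivity set of mixed clipping: the vectors `s` with `‖s‖_p ≤ c` and `‖s‖_∞ ≤ cinf`. -/
def mixedBall (d : ℕ) (p c cinf : ℝ) : Set (Fin d → ℝ) :=
  {s | (∑ l, |s l| ^ p) ^ (1 / p) ≤ c ∧ ∀ l, |s l| ≤ cinf}

/-- The probability that Poisson sampling with rate `q` from the index set `I` selects exactly the
subset `J ⊆ I`: every index is selected independently with probability `q`. -/
def sampleProb {ι : Type*} [DecidableEq ι] (q : ℝ) (I J : Finset ι) : ℝ :=
  q ^ J.card * (1 - q) ^ (I \ J).card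

/-- Law of the `l`-th output coordinate of coordinate-wise sampling from the (clipped) vectors
`y i`, `i ∈ I`: a subset `J ⊆ I` is drawn by Poisson sampling with rate `q`, and Gaussian noise of
variance `σ ^ 2` is added to `∑ i ∈ J, y i l`. -/
def coordinateLaw {ι : Type*} [DecidableEq ι] {d : ℕ} (q σ : ℝ) (y : ι → Fin d → ℝ)
    (I : Finset ι) (l : Fin d) : Measure ℝ :=
  ∑ J ∈ I.powerset, ENNReal.ofReal (sampleProb q I J) •
    gaussianReal (∑ i ∈ J, y i l) (Real.toNNReal (σ ^ 2))

/-- Output law of private aggregation with `q`-coordinate-wise Poisson sampling from the (clipped)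
vectors `y i`, `i ∈ I`: sampling and noise are independent across the coordinates. -/
def coordinateSampling {ι : Type*} [DecidableEq ι] {d : ℕ} (q σ : ℝ) (y : ι → Fin d → ℝ)
    (I : Finset ι) : Measure (Fin d → ℝ) :=
  Measure.pi fun l => coordinateLaw q σ y I l

/-- Output law of `(q₁, q₂)`-twice Poisson sampling on the dataset `X`, with processing function
`F`, clipping operator `CP` and noise variance `σ ^ 2`: first a subset `I` of the datapoints is
drawn by Poisson sampling with rate `q₁`, and then `q₂`-coordinate-wise sampling is applied to the
clipped vectors `CP (F x)` of the selected datapoints `x`. -/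
def twiceSampling {𝒳 : Type*} {d : ℕ} (q₁ q₂ σ : ℝ) (CP : (Fin d → ℝ) → (Fin d → ℝ))
    (F : 𝒳 → Fin d → ℝ) (X : List 𝒳) : Measure (Fin d → ℝ) :=
  ∑ I : Finset (Fin X.length), ENNReal.ofReal (sampleProb q₁ Finset.univ I) •
    coordinateSampling q₂ σ (fun i => CP (F (X.get i))) I

/-- The RDP parameter `ε(α)` of twice sampling, as a function of `α`, `q₁`, `q₂` and `τ`. -/
def epsTwice (α : ℕ) (q₁ q₂ τ : ℝ) : ℝ :=
  Real.log ((1 - q₁) ^ α + ∑ v ∈ Finset.Icc 1 α,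
    (α.choose v : ℝ) * (1 - q₁) ^ (α - v) * q₁ ^ v *
      Real.exp ((v : ℝ) * ((v : ℝ) - 1) * q₂ ^ 2 * τ)) / ((α : ℝ) - 1)

end TwiceSampling

end

/-! Fix the sampling choices made for the points common to two adjacent datasets. Given these
choices, the output is a translate of the centred Gaussian `γ`, or of `W γ` if the extra vector `s`
is in the dataset, where `W = (1 - q₁) + q₁ ∏ ((1 - q₂) + q₂ L_l)` and `L_l` is the likelihood ratio
of a shift by `s l`. Both laws are therefore mixtures, with common weights and common translations,
and joint convexity of `b ^ α / a ^ (α - 1)` with translation invariance reduces everything to the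
pair `W γ`, `γ` (`renyiDiv_twiceLaw_insert_le`).

Adding the point requires a bound on `∫ W ^ α dγ`, removing it one on `∫ W ^ (-(α - 1)) dγ`. The
second integral is at most the first (`lintegral_inv_mixRatio_pow_le`). In one dimension the
reflection `x ↦ s - x` inverts `L`, and the symmetrised integrands compare pointwise. Higher
dimensions follow by induction with a Chebyshev-type correlation argument.

Expanding `W ^ α` binomially leaves, for each `v ≤ α`, a product over the coordinates of `E exp (j
(j - 1) t_l)` with `j` binomial of parameters `v`, `q₂` and `t_l = s_l² / (2σ²)`. Since `E j (j - 1)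
= v (v - 1) q₂²`, each factor is at most `exp (v (v - 1) q₂² (1 + y) t_l)` once `α² t_l ≤ y ≤ 1`
(`binomExp_le_exp`), so only `(1 + y) ∑ t_l` matters. With `r = c_∞ / c_p`, mixed clipping gives `∑
t_l ≤ τ r ^ (2 - p)` and permits `y = α² τ r²`. As `d₀` grows, `r` tends to `0`: for `p < 2` the
power of `r` beats `1 + y`, so no slack is needed, and for `p = 2` the excess `y τ` is absorbed by
`η`.

The second claim is the same exponential estimate with `y = 1`, applied to the outer binomial sum;
hence `C = 2`. -/

noncomputable section

namespace TwiceSampling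

/-! ### The binomial sum -/

/-- The expectation of `exp (j (j - 1) t)` for a binomial random variable `j`. -/
def binomExp (n : ℕ) (q t : ℝ) : ℝ :=
  ∑ j ∈ Finset.range (n + 1),
    q ^ j * (1 - q) ^ (n - j) * (n.choose j : ℝ) * Real.exp ((j : ℝ) * ((j : ℝ) - 1) * t)

lemma sum_binomial (n : ℕ) (q : ℝ) :
    ∑ j ∈ Finset.range (n + 1), q ^ j * (1 - q) ^ (n - j) * (n.choose j : ℝ) = 1 := by
  rw [← add_pow]; simp

lemma sum_binomial_mul_factorial (n : ℕ) (q : ℝ) :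
    ∑ j ∈ Finset.range (n + 1),
      q ^ j * (1 - q) ^ (n - j) * (n.choose j : ℝ) * ((j : ℝ) * ((j : ℝ) - 1))
      = (n : ℝ) * ((n : ℝ) - 1) * q ^ 2 := by
  have cast_pred (k : ℕ) : ((k * (k - 1) : ℕ) : ℝ) = (k : ℝ) * ((k : ℝ) - 1) := by
    cases k <;> simp
  have h := congrArg (Polynomial.eval q) (bernsteinPolynomial.sum_mul_smul ℝ n)
  simp only [Polynomial.eval_finsetSum, bernsteinPolynomial,
    Polynomial.eval_mul, Polynomial.eval_pow, Polynomial.eval_sub, Polynomial.eval_one,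
    Polynomial.eval_X, Polynomial.eval_natCast, nsmul_eq_mul, cast_pred] at h
  rw [← h]
  refine Finset.sum_congr rfl fun j _ => ?_
  ring

/-- A linear bound on the exponential passes through the expectation, and `j (j - 1)` has mean
exactly `n (n - 1) q²`. This is the source of the squared sampling rate. -/
lemma binomExp_le {n : ℕ} {q t κ : ℝ} (hq : q ∈ Set.Icc (0 : ℝ) 1)
    (h : ∀ j ≤ n, Real.exp ((j : ℝ) * ((j : ℝ) - 1) * t) ≤ 1 + κ * ((j : ℝ) * ((j : ℝ) - 1) * t)) :
    binomExp n q t ≤ 1 + κ * ((n : ℝ) * ((n : ℝ) - 1) * q ^ 2 * t) := by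
  have h1q : 0 ≤ 1 - q := by linarith [hq.2]
  have hq0 := hq.1
  calc binomExp n q t
      ≤ ∑ j ∈ Finset.range (n + 1), q ^ j * (1 - q) ^ (n - j) * (n.choose j : ℝ) *
          (1 + κ * ((j : ℝ) * ((j : ℝ) - 1) * t)) := by
        refine Finset.sum_le_sum fun j hj => ?_
        exact mul_le_mul_of_nonneg_left (h j (by simpa [Nat.lt_succ_iff] using hj)) (by positivity)
    _ = 1 + κ * ((n : ℝ) * ((n : ℝ) - 1) * q ^ 2 * t) := by
        simp_rw [mul_add, Finset.sum_add_distrib, mul_one]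
        rw [sum_binomial, ← sum_binomial_mul_factorial, Finset.sum_mul, Finset.mul_sum]
        congr 1
        refine Finset.sum_congr rfl fun j _ => ?_
        ring

lemma natCast_mul_pred_nonneg (j : ℕ) : 0 ≤ (j : ℝ) * ((j : ℝ) - 1) := by
  cases j with
  | zero => simp
  | succ k => push_cast; nlinarith [(Nat.cast_nonneg k : (0 : ℝ) ≤ k)]

lemma natCast_mul_pred_le {j n : ℕ} (h : j ≤ n) :
    (j : ℝ) * ((j : ℝ) - 1) ≤ (n : ℝ) * ((n : ℝ) - 1) := by
  rcases Nat.eq_zero_or_pos j with rfl | hj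
  · simpa using natCast_mul_pred_nonneg n
  · have h1 : (1 : ℝ) ≤ j := by exact_mod_cast hj
    have h2 : (j : ℝ) ≤ n := by exact_mod_cast h
    nlinarith

lemma natCast_mul_pred_le_sq {j n : ℕ} (h : j ≤ n) :
    (j : ℝ) * ((j : ℝ) - 1) ≤ (n : ℝ) ^ 2 := by
  have := natCast_mul_pred_le h
  nlinarith [(Nat.cast_nonneg n : (0 : ℝ) ≤ n)]

/-- Individual weights vanish at `q = 0` or `q = 1`, so positivity comes from a uniform lower bound
on the exponentials, averaged against weights of total mass one. -/
lemma binomExp_pos (n : ℕ) {q : ℝ} (hq : q ∈ Set.Icc (0 : ℝ) 1) (t : ℝ) : 0 < binomExp n q t := by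
  have h1q : 0 ≤ 1 - q := by linarith [hq.2]
  have hq0 := hq.1
  refine lt_of_lt_of_le (Real.exp_pos (-((n : ℝ) ^ 2 * |t|))) ?_
  calc Real.exp (-((n : ℝ) ^ 2 * |t|))
      = ∑ j ∈ Finset.range (n + 1), q ^ j * (1 - q) ^ (n - j) * (n.choose j : ℝ) *
          Real.exp (-((n : ℝ) ^ 2 * |t|)) := by
        rw [← Finset.sum_mul, sum_binomial, one_mul]
    _ ≤ binomExp n q t := by
        refine Finset.sum_le_sum fun j hj => ?_
        refine mul_le_mul_of_nonneg_left (Real.exp_le_exp.2 ?_) (by positivity)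
        have h1 := natCast_mul_pred_le_sq (Nat.lt_succ_iff.1 (Finset.mem_range.1 hj))
        have h2 := natCast_mul_pred_nonneg j
        have h3 := mul_le_mul_of_nonneg_right h1 (abs_nonneg t)
        have h4 := mul_le_mul_of_nonneg_left (neg_abs_le t) h2
        linarith

/-- The remainder of `exp x` after `1 + x` is at most `x²`, hence at most `y x`. -/
lemma exp_le_one_add_mul {x y : ℝ} (hx : 0 ≤ x) (hxy : x ≤ y) (hy : y ≤ 1) :
    Real.exp x ≤ 1 + (1 + y) * x := by
  have := abs_le.1 (Real.abs_exp_sub_one_sub_id_le (x := x) (by rw [abs_of_nonneg hx]; linarith))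
  nlinarith [this.2]

/-- For small `t`, the binomial sum is dominated by its second-order expansion. -/
lemma binomExp_le_exp {n m : ℕ} (hn : n ≤ m) {q t y : ℝ} (hq : q ∈ Set.Icc (0 : ℝ) 1) (ht : 0 ≤ t)
    (hty : (m : ℝ) ^ 2 * t ≤ y) (hy : y ≤ 1) :
    binomExp n q t ≤ Real.exp ((n : ℝ) * ((n : ℝ) - 1) * q ^ 2 * ((1 + y) * t)) := by
  have := binomExp_le (n := n) (t := t) (κ := 1 + y) hq fun j hj =>
    exp_le_one_add_mul (mul_nonneg (natCast_mul_pred_nonneg j) ht)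
      ((mul_le_mul_of_nonneg_right (natCast_mul_pred_le_sq (hj.trans hn)) ht).trans hty) hy
  refine this.trans (le_trans (le_of_eq ?_) (Real.add_one_le_exp _))
  ring

lemma epsTwice_eq (α : ℕ) (q₁ q₂ τ : ℝ) :
    epsTwice α q₁ q₂ τ = Real.log (binomExp α q₁ (q₂ ^ 2 * τ)) / ((α : ℝ) - 1) := by
  unfold epsTwice binomExp
  congr 2
  rw [Finset.range_eq_Ico, Finset.sum_eq_sum_Ico_succ_bot (by omega)]
  congr 1
  · simp
  · refine Finset.sum_congr rfl fun j _ => ?_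
    rw [mul_assoc _ (q₂ ^ 2) τ]
    ring

theorem epsTwice_le {α : ℕ} {τ q₁ q₂ : ℝ} (hα : 2 ≤ α) (hτ : 0 < τ)
    (hq₁ : q₁ ∈ Set.Icc (0 : ℝ) 1) (h : (α : ℝ) ^ 2 * (q₂ ^ 2 * τ) ≤ 1) :
    epsTwice α q₁ q₂ τ ≤ 2 * ((α : ℝ) * (q₁ * q₂) ^ 2 * τ) := by
  have hα1 : (0 : ℝ) < (α : ℝ) - 1 := by
    have : (2 : ℝ) ≤ α := by exact_mod_cast hα
    linarith
  rw [epsTwice_eq, div_le_iff₀ hα1]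
  -- The choice `y = 1` makes `1 + y` the constant `2` of the conclusion.
  have h1 := binomExp_le_exp (le_refl α) hq₁ (by positivity) h le_rfl
  calc Real.log (binomExp α q₁ (q₂ ^ 2 * τ)) ≤ _ := Real.log_le_log (binomExp_pos α hq₁ _) h1
    _ = _ := by rw [Real.log_exp]; ring

/-! ### A pointwise inequality -/

/-- The difference of the two sides is `D (n + 1)` for a sequence with `D 0 = D 1 = 0`, both by `u +
y w = 1 + y`. The powers of `w` and `w⁻¹` are annihilated by the recurrence with coefficient `w +
w⁻¹`, and the powers of `u` leave a nonnegative remainder. As `w + w⁻¹ ≥ 2`, `D` is convex as long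
as it is nonnegative, and so it never decreases. -/
lemma add_mul_inv_pow_le_of_one_le {u w y : ℝ} (hw : 0 < w) (hw1 : w ≤ 1) (hu : 1 ≤ u)
    (huw : 1 ≤ u * w) (h : u + y * w = 1 + y) (n : ℕ) :
    (u⁻¹) ^ n + y * (w⁻¹) ^ n ≤ u ^ (n + 1) + y * w ^ (n + 1) := by
  have hu0 : 0 < u := by linarith
  set D : ℕ → ℝ := fun n => u ^ n + y * w ^ n - u * (u⁻¹) ^ n - y * w * (w⁻¹) ^ n with hD
  have step (n : ℕ) : (w + w⁻¹) * D (n + 1) - D n ≤ D (n + 2) := by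
    have key : D (n + 2) - ((w + w⁻¹) * D (n + 1) - D n) =
        (u - w) * (u - w⁻¹) * (u ^ n - u⁻¹ * (u⁻¹) ^ n) := by
      simp only [hD, pow_succ]
      generalize u⁻¹ ^ n = a
      generalize w⁻¹ ^ n = b
      field_simp
      ring
    have h1 : w⁻¹ ≤ u := by rw [inv_le_iff_one_le_mul₀ hw]; exact huw
    have h2 : u⁻¹ * (u⁻¹) ^ n ≤ u ^ n := by
      have hu' : u⁻¹ ≤ 1 := inv_le_one_of_one_le₀ hu
      calc u⁻¹ * (u⁻¹) ^ n ≤ 1 * 1 :=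
            mul_le_mul hu' (pow_le_one₀ (by positivity) hu') (by positivity) (by norm_num)
        _ ≤ u ^ n := by simpa using one_le_pow₀ hu
    have : 0 ≤ D (n + 2) - ((w + w⁻¹) * D (n + 1) - D n) := by
      rw [key]
      exact mul_nonneg (mul_nonneg (by linarith) (by linarith)) (by linarith)
    linarith
  have hw2 : 2 ≤ w + w⁻¹ := by
    have : w + w⁻¹ - 2 = (w - 1) ^ 2 / w := by field_simp; ring
    have : 0 ≤ (w - 1) ^ 2 / w := by positivity
    linarith
  have mono (n : ℕ) : 0 ≤ D n ∧ D n ≤ D (n + 1) := by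
    induction n with
    | zero =>
      have h0 : D 0 = 0 := by simp only [hD, pow_zero]; linarith
      have h1 : D 1 = 0 := by
        simp only [hD, pow_one]; field_simp; linarith
      simp [h0, h1]
    | succ n ih =>
      refine ⟨ih.1.trans ih.2, ?_⟩
      have := step n
      nlinarith [ih.1, ih.2]
  have h := (mono (n + 1)).1
  have e1 : u * (u⁻¹) ^ (n + 1) = (u⁻¹) ^ n := by rw [pow_succ']; field_simp
  have e2 : y * w * (w⁻¹) ^ (n + 1) = y * (w⁻¹) ^ n := by rw [pow_succ']; field_simp
  simp only [hD, e1, e2] at h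
  linarith

/-- The pointwise inequality behind the comparison of the two directions of the Rényi divergence
of a symmetric pair. -/
lemma add_mul_inv_pow_le {ρ y : ℝ} (hρ : ρ ∈ Set.Icc (0 : ℝ) 1) (hy : 0 < y) (n : ℕ) :
    (((1 - ρ) + ρ * y)⁻¹) ^ n + y * (((1 - ρ) + ρ * y⁻¹)⁻¹) ^ n
      ≤ ((1 - ρ) + ρ * y) ^ (n + 1) + y * ((1 - ρ) + ρ * y⁻¹) ^ (n + 1) := by
  obtain ⟨h0, h1⟩ := hρ
  have main : ∀ y : ℝ, 1 ≤ y → (((1 - ρ) + ρ * y)⁻¹) ^ n + y * (((1 - ρ) + ρ * y⁻¹)⁻¹) ^ n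
      ≤ ((1 - ρ) + ρ * y) ^ (n + 1) + y * ((1 - ρ) + ρ * y⁻¹) ^ (n + 1) := by
    intro y hy
    have hy0 : 0 < y := by linarith
    have hyi : y⁻¹ ≤ 1 := inv_le_one_of_one_le₀ hy
    have hyi0 : 0 < y⁻¹ := by positivity
    refine add_mul_inv_pow_le_of_one_le ?_ ?_ ?_ ?_ ?_ n
    · rcases h1.lt_or_eq with h | rfl
      · have := mul_nonneg h0 hyi0.le
        linarith
      · simpa using hy0
    · nlinarith
    · nlinarith
    · have : ((1 - ρ) + ρ * y) * ((1 - ρ) + ρ * y⁻¹) = 1 + ρ * (1 - ρ) * (y - 1) ^ 2 / y := by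
        field_simp; ring
      have h2 : 0 ≤ 1 - ρ := by linarith
      have : 0 ≤ ρ * (1 - ρ) * (y - 1) ^ 2 / y := by positivity
      linarith
    · field_simp; ring
  rcases le_total 1 y with h | h
  · exact main y h
  -- Passing to `y⁻¹` swaps the two bases, and multiplying by `y` restores the weights.
  · have h' := mul_le_mul_of_nonneg_left (main y⁻¹ (one_le_inv_iff₀.2 ⟨hy, h⟩)) hy.le
    rw [inv_inv, mul_add, mul_add, ← mul_assoc, ← mul_assoc, mul_inv_cancel₀ hy.ne', one_mul,
      one_mul] at h'
    linarith

/-! ### Gaussian likelihood ratios -/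

/-- The density of `N(s, v)` with respect to `N(0, v)`. -/
def shiftRatio (v : NNReal) (s x : ℝ) : ℝ := Real.exp ((s * x - s ^ 2 / 2) / v)

lemma shiftRatio_pos (v : NNReal) (s x : ℝ) : 0 < shiftRatio v s x := Real.exp_pos _

@[fun_prop]
lemma measurable_shiftRatio (v : NNReal) (s : ℝ) : Measurable (shiftRatio v s) := by
  unfold shiftRatio; fun_prop

lemma shiftRatio_const_sub (v : NNReal) (s x : ℝ) :
    shiftRatio v s (s - x) = (shiftRatio v s x)⁻¹ := by
  rw [shiftRatio, shiftRatio, ← Real.exp_neg]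
  congr 1
  ring

lemma shiftRatio_mul_gaussianPDFReal {v : NNReal} (hv : v ≠ 0) (s x : ℝ) :
    shiftRatio v s x * gaussianPDFReal 0 v x = gaussianPDFReal s v x := by
  have hv' : (v : ℝ) ≠ 0 := by exact_mod_cast hv
  rw [gaussianPDFReal, gaussianPDFReal, shiftRatio, mul_left_comm, ← Real.exp_add]
  congr 2
  field_simp
  ring

lemma gaussianReal_eq_withDensity {v : NNReal} (hv : v ≠ 0) (s : ℝ) :
    gaussianReal s v
      = (gaussianReal 0 v).withDensity fun x => ENNReal.ofReal (shiftRatio v s x) := by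
  rw [gaussianReal_of_var_ne_zero 0 hv, gaussianReal_of_var_ne_zero s hv,
    ← withDensity_mul _ (measurable_gaussianPDF 0 v) (by fun_prop)]
  congr 1
  ext x
  simp only [gaussianPDF, Pi.mul_apply]
  rw [← ENNReal.ofReal_mul (gaussianPDFReal_nonneg _ _ _), mul_comm,
    shiftRatio_mul_gaussianPDFReal hv]

/-- The reflection `x ↦ s - x` carries `N(s, v)` to `N(0, v)`, and `shiftRatio` is the density of
the former with respect to the latter. -/
lemma lintegral_gaussianReal_reflect {v : NNReal} (hv : v ≠ 0) (s : ℝ) {h : ℝ → ℝ≥0∞}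
    (hh : Measurable h) :
    ∫⁻ x, h x ∂(gaussianReal 0 v)
      = ∫⁻ x, ENNReal.ofReal (shiftRatio v s x) * h (s - x) ∂(gaussianReal 0 v) := by
  have h1 : (gaussianReal s v).map (fun x => s - x) = gaussianReal 0 v := by
    rw [gaussianReal_map_const_sub, sub_self]
  conv_lhs => rw [← h1]
  rw [lintegral_map hh (by fun_prop), gaussianReal_eq_withDensity hv,
    lintegral_withDensity_eq_lintegral_mul _ (by fun_prop) (by fun_prop)]
  rfl

lemma lintegral_shiftRatio_pow {v : NNReal} (hv : v ≠ 0) (s : ℝ) (j : ℕ) :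
    ∫⁻ x, ENNReal.ofReal (shiftRatio v s x ^ j) ∂(gaussianReal 0 v)
      = ENNReal.ofReal (Real.exp ((j : ℝ) * ((j : ℝ) - 1) * (s ^ 2 / (2 * v)))) := by
  have hv' : (v : ℝ) ≠ 0 := by exact_mod_cast hv
  have e : ∀ x, shiftRatio v s x ^ j
      = Real.exp (-(j * (s ^ 2 / (2 * v)))) * Real.exp ((j * s / v) * x) := by
    intro x
    rw [shiftRatio, ← Real.exp_nat_mul, ← Real.exp_add]
    congr 1
    field_simp
    ring
  simp_rw [e]
  rw [← ofReal_integral_eq_lintegral_ofReal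
    ((integrable_exp_mul_gaussianReal _).const_mul _) (ae_of_all _ fun x => by positivity),
    integral_const_mul]
  have := congrFun (mgf_fun_id_gaussianReal (μ := 0) (v := v)) (j * s / v)
  rw [mgf] at this
  rw [this, ← Real.exp_add]
  congr 2
  field_simp
  ring

lemma lintegral_mix_pow {Ω : Type*} [MeasurableSpace Ω] (μ : Measure Ω) {q : ℝ}
    (hq : q ∈ Set.Icc (0 : ℝ) 1) {f : Ω → ℝ} (hf : Measurable f) (hf0 : ∀ x, 0 ≤ f x) (n : ℕ) :
    ∫⁻ x, ENNReal.ofReal (((1 - q) + q * f x) ^ n) ∂μ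
      = ∑ j ∈ Finset.range (n + 1), ENNReal.ofReal (q ^ j * (1 - q) ^ (n - j) * (n.choose j : ℝ)) *
          ∫⁻ x, ENNReal.ofReal (f x ^ j) ∂μ := by
  have h1q : 0 ≤ 1 - q := by linarith [hq.2]
  have hq0 := hq.1
  have e : ∀ x, ENNReal.ofReal (((1 - q) + q * f x) ^ n)
      = ∑ j ∈ Finset.range (n + 1), ENNReal.ofReal (q ^ j * (1 - q) ^ (n - j) * (n.choose j : ℝ)) *
          ENNReal.ofReal (f x ^ j) := by
    intro x
    rw [add_comm, add_pow, ENNReal.ofReal_sum_of_nonneg]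
    · refine Finset.sum_congr rfl fun j _ => ?_
      rw [← ENNReal.ofReal_mul (by positivity)]
      congr 1
      ring
    · intro j _
      have := hf0 x
      positivity
  simp_rw [e]
  rw [lintegral_finsetSum _ (fun j _ => by fun_prop)]
  exact Finset.sum_congr rfl fun j _ => lintegral_const_mul _ (by fun_prop)

/-- Besides evaluating moments, this representation lets inequalities for `binomExp` be proved
pointwise under the Gaussian integral. -/
lemma lintegral_mix_shiftRatio_pow {v : NNReal} (hv : v ≠ 0) {q : ℝ}
    (hq : q ∈ Set.Icc (0 : ℝ) 1) (s : ℝ) (n : ℕ) :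
    ∫⁻ x, ENNReal.ofReal (((1 - q) + q * shiftRatio v s x) ^ n) ∂(gaussianReal 0 v)
      = ENNReal.ofReal (binomExp n q (s ^ 2 / (2 * v))) := by
  have h1q : 0 ≤ 1 - q := by linarith [hq.2]
  have hq0 := hq.1
  rw [lintegral_mix_pow _ hq (measurable_shiftRatio v s) (fun x => (shiftRatio_pos v s x).le),
    binomExp, ENNReal.ofReal_sum_of_nonneg (fun j _ => by positivity)]
  refine Finset.sum_congr rfl fun j _ => ?_
  rw [lintegral_shiftRatio_pow hv, ← ENNReal.ofReal_mul (by positivity)]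

lemma mix_pos {q y : ℝ} (hq : q ∈ Set.Icc (0 : ℝ) 1) (hy : 0 < y) : 0 < (1 - q) + q * y := by
  obtain ⟨h0, h1⟩ := hq
  rcases h1.lt_or_eq with h | rfl
  · have := mul_nonneg h0 hy.le
    linarith
  · simpa using hy

/-- For a Gaussian shift mixture, the removal direction is dominated by the addition direction. -/
lemma lintegral_inv_mix_shiftRatio_pow_le {v : NNReal} (hv : v ≠ 0) {q : ℝ}
    (hq : q ∈ Set.Icc (0 : ℝ) 1) (s : ℝ) (n : ℕ) :
    ∫⁻ x, ENNReal.ofReal ((((1 - q) + q * shiftRatio v s x)⁻¹) ^ n) ∂(gaussianReal 0 v)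
      ≤ ENNReal.ofReal (binomExp (n + 1) q (s ^ 2 / (2 * v))) := by
  rw [← lintegral_mix_shiftRatio_pow hv hq]
  set γ := gaussianReal 0 v
  -- Adding the reflected form of the integral, in which the ratio is inverted, produces the
  -- symmetrised integrand of `add_mul_inv_pow_le`.
  have double : ∀ f : ℝ → ℝ, Measurable f → (∀ y, 0 < y → 0 ≤ f y) →
      2 * ∫⁻ x, ENNReal.ofReal (f (shiftRatio v s x)) ∂γ
        = ∫⁻ x, ENNReal.ofReal (f (shiftRatio v s x)
            + shiftRatio v s x * f (shiftRatio v s x)⁻¹) ∂γ := by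
    intro f hf hf0
    have h := lintegral_gaussianReal_reflect hv s
      (h := fun x => ENNReal.ofReal (f (shiftRatio v s x))) (by fun_prop)
    rw [two_mul]
    nth_rewrite 2 [h]
    rw [← lintegral_add_left (by fun_prop)]
    refine lintegral_congr fun x => ?_
    have hp := shiftRatio_pos v s x
    rw [shiftRatio_const_sub, ← ENNReal.ofReal_mul hp.le,
      ← ENNReal.ofReal_add (hf0 _ hp) (mul_nonneg hp.le (hf0 _ (inv_pos.2 hp)))]
  have h1 := double (fun y => (((1 - q) + q * y)⁻¹) ^ n) (by fun_prop)
    (fun y hy => by have := mix_pos hq hy; positivity)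
  have h2 := double (fun y => ((1 - q) + q * y) ^ (n + 1)) (by fun_prop)
    (fun y hy => by have := mix_pos hq hy; positivity)
  have h3 : 2 * ∫⁻ x, ENNReal.ofReal ((((1 - q) + q * shiftRatio v s x)⁻¹) ^ n) ∂γ
      ≤ 2 * ∫⁻ x, ENNReal.ofReal (((1 - q) + q * shiftRatio v s x) ^ (n + 1)) ∂γ := by
    rw [h1, h2]
    exact lintegral_mono fun x => ENNReal.ofReal_le_ofReal
      (add_mul_inv_pow_le hq (shiftRatio_pos v s x) n)
  exact (ENNReal.mul_le_mul_iff_right (by norm_num) (by norm_num)).1 h3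

lemma one_le_binomExp (n : ℕ) {q t : ℝ} (hq : q ∈ Set.Icc (0 : ℝ) 1) (ht : 0 ≤ t) :
    1 ≤ binomExp n q t := by
  have h1q : 0 ≤ 1 - q := by linarith [hq.2]
  have hq0 := hq.1
  rw [← sum_binomial n q]
  refine Finset.sum_le_sum fun j _ => le_mul_of_one_le_right (by positivity) ?_
  exact Real.one_le_exp (mul_nonneg (natCast_mul_pred_nonneg j) ht)

/-- With `θ = q / q'`, the mixture of rate `q` is the `θ`-average of the constant `1` and the
mixture of rate `q'`. Convexity of the power gives the bound `(1 - θ) + θ * binomExp n q' _`, and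
the last factor is at least `1`. -/
lemma binomExp_mono {v : NNReal} (hv : v ≠ 0) (n : ℕ) {q q' : ℝ} (s : ℝ) (hq : 0 ≤ q)
    (hqq : q ≤ q') (hq' : q' ≤ 1) :
    binomExp n q (s ^ 2 / (2 * v)) ≤ binomExp n q' (s ^ 2 / (2 * v)) := by
  have ht : 0 ≤ s ^ 2 / (2 * (v : ℝ)) := by positivity
  rcases hq.eq_or_lt with rfl | hq0
  · refine le_trans (le_of_eq ?_) (one_le_binomExp n ⟨hqq, hq'⟩ ht)
    rw [binomExp, Finset.sum_eq_single 0] <;> simp +contextual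
  have hq'0 : 0 < q' := by linarith
  have hI : q ∈ Set.Icc (0 : ℝ) 1 := ⟨hq, hqq.trans hq'⟩
  have hI' : q' ∈ Set.Icc (0 : ℝ) 1 := ⟨hq'0.le, hq'⟩
  have hθ : q / q' ∈ Set.Icc (0 : ℝ) 1 := ⟨by positivity, by rwa [div_le_one hq'0]⟩
  have key : ENNReal.ofReal (binomExp n q (s ^ 2 / (2 * v)))
      ≤ ENNReal.ofReal ((1 - q / q') + q / q' * binomExp n q' (s ^ 2 / (2 * v))) := by
    rw [ENNReal.ofReal_add (by linarith [hθ.2]) (mul_nonneg hθ.1 (binomExp_pos n hI' _).le),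
      ENNReal.ofReal_mul hθ.1, ← lintegral_mix_shiftRatio_pow hv hI,
      ← lintegral_mix_shiftRatio_pow hv hI', ← lintegral_const_mul _ (by fun_prop)]
    have : ENNReal.ofReal (1 - q / q')
        = ∫⁻ _, ENNReal.ofReal (1 - q / q') ∂(gaussianReal 0 v) := by simp
    rw [this, ← lintegral_add_left (by fun_prop)]
    refine lintegral_mono fun x => ?_
    have hp := mix_pos hI' (shiftRatio_pos v s x)
    rw [← ENNReal.ofReal_mul hθ.1, ← ENNReal.ofReal_add (by linarith [hθ.2])
      (mul_nonneg hθ.1 (by positivity))]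
    refine ENNReal.ofReal_le_ofReal ?_
    have := (convexOn_pow (𝕜 := ℝ) n).2 (Set.mem_Ici.2 zero_le_one) (Set.mem_Ici.2 hp.le)
      (sub_nonneg.2 hθ.2) hθ.1 (sub_add_cancel 1 (q / q'))
    simp only [smul_eq_mul, mul_one, one_pow] at this
    refine le_trans (le_of_eq ?_) this
    congr 1
    field_simp
    ring
  have h1 := one_le_binomExp n hI' ht
  rw [ENNReal.ofReal_le_ofReal_iff (by nlinarith [hθ.1, hθ.2])] at key
  nlinarith [hθ.1, hθ.2]

/-! ### Product measures -/

lemma lintegral_pi_succ {d : ℕ} (μ : Fin (d + 1) → Measure ℝ) [∀ l, SigmaFinite (μ l)]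
    {F : (Fin (d + 1) → ℝ) → ℝ≥0∞} (hF : Measurable F) :
    ∫⁻ x, F x ∂(Measure.pi μ)
      = ∫⁻ y, ∫⁻ a, F (Fin.cons a y) ∂(μ 0) ∂(Measure.pi fun l : Fin d => μ l.succ) := by
  have h := (measurePreserving_piFinSuccAbove μ 0).symm
  rw [← h.lintegral_comp hF,
    lintegral_prod_symm' (fun z => F ((MeasurableEquiv.piFinSuccAbove (fun _ => ℝ) 0).symm z))
      (hF.comp h.measurable)]
  simp [MeasurableEquiv.piFinSuccAbove_symm_apply, Fin.insertNthEquiv]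

lemma lintegral_pi_prod {d : ℕ} (μ : Fin d → Measure ℝ) [∀ l, SigmaFinite (μ l)]
    {f : Fin d → ℝ → ℝ≥0∞} (hf : ∀ l, Measurable (f l)) :
    ∫⁻ x, ∏ l, f l (x l) ∂(Measure.pi μ) = ∏ l, ∫⁻ a, f l a ∂(μ l) := by
  induction d with
  | zero => simp
  | succ d ih =>
    rw [lintegral_pi_succ μ (by fun_prop), Fin.prod_univ_succ]
    simp only [Fin.prod_univ_succ, Fin.cons_zero, Fin.cons_succ]
    simp_rw [lintegral_mul_const _ (hf 0)]
    rw [lintegral_const_mul _ (by fun_prop), ih (fun l => μ l.succ) fun l => hf _]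

lemma pi_withDensity {d : ℕ} {f : Fin d → ℝ → ℝ≥0∞} (hf : ∀ l, Measurable (f l))
    [∀ l, SigmaFinite ((volume : Measure ℝ).withDensity (f l))] :
    Measure.pi (fun l => (volume : Measure ℝ).withDensity (f l))
      = (volume : Measure (Fin d → ℝ)).withDensity fun x => ∏ l, f l (x l) := by
  refine Measure.pi_eq fun s hs => ?_
  rw [withDensity_apply _ (MeasurableSet.univ_pi hs), volume_pi, Measure.restrict_pi_pi,
    lintegral_pi_prod _ hf]
  exact Finset.prod_congr rfl fun l _ => (withDensity_apply _ (hs l)).symm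

/-- The density, with respect to the centred Gaussian law, of the law of coordinate-wise sampling
from the single vector `s`. -/
def prodRatio {d : ℕ} (v : NNReal) (q : ℝ) (s x : Fin d → ℝ) : ℝ :=
  ∏ l, ((1 - q) + q * shiftRatio v (s l) (x l))

@[fun_prop]
lemma measurable_prodRatio {d : ℕ} (v : NNReal) (q : ℝ) (s : Fin d → ℝ) :
    Measurable (prodRatio v q s) := by
  unfold prodRatio; fun_prop

lemma prodRatio_pos {d : ℕ} (v : NNReal) {q : ℝ} (hq : q ∈ Set.Icc (0 : ℝ) 1) (s x : Fin d → ℝ) :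
    0 < prodRatio v q s x :=
  Finset.prod_pos fun _ _ => mix_pos hq (shiftRatio_pos _ _ _)

lemma prodRatio_succ {d : ℕ} (v : NNReal) (q : ℝ) (s : Fin (d + 1) → ℝ) (a : ℝ) (y : Fin d → ℝ) :
    prodRatio v q s (Fin.cons a y)
      = ((1 - q) + q * shiftRatio v (s 0) a) * prodRatio v q (fun l => s l.succ) y := by
  simp [prodRatio, Fin.prod_univ_succ]

lemma lintegral_prodRatio_pow {d : ℕ} {v : NNReal} (hv : v ≠ 0) {q : ℝ}
    (hq : q ∈ Set.Icc (0 : ℝ) 1) (s : Fin d → ℝ) (n : ℕ) :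
    ∫⁻ x, ENNReal.ofReal (prodRatio v q s x ^ n) ∂(Measure.pi fun _ => gaussianReal 0 v)
      = ENNReal.ofReal (∏ l, binomExp n q (s l ^ 2 / (2 * v))) := by
  rw [ENNReal.ofReal_prod_of_nonneg fun l _ => (binomExp_pos n hq _).le]
  simp_rw [← lintegral_mix_shiftRatio_pow hv hq]
  rw [← lintegral_pi_prod (fun _ => gaussianReal 0 v) fun l => by fun_prop]
  refine lintegral_congr fun x => ?_
  rw [← ENNReal.ofReal_prod_of_nonneg fun l _ => by
    have := mix_pos hq (shiftRatio_pos v (s l) (x l)); positivity, Finset.prod_pow, prodRatio]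

/-- The density of the mixture in which the sampled vector is present with probability `q₁`. -/
def mixRatio {d : ℕ} (v : NNReal) (q₁ q₂ : ℝ) (s x : Fin d → ℝ) : ℝ :=
  (1 - q₁) + q₁ * prodRatio v q₂ s x

@[fun_prop]
lemma measurable_mixRatio {d : ℕ} (v : NNReal) (q₁ q₂ : ℝ) (s : Fin d → ℝ) :
    Measurable (mixRatio v q₁ q₂ s) := by
  unfold mixRatio; fun_prop

lemma mixRatio_pos {d : ℕ} (v : NNReal) {q₁ q₂ : ℝ} (hq₁ : q₁ ∈ Set.Icc (0 : ℝ) 1)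
    (hq₂ : q₂ ∈ Set.Icc (0 : ℝ) 1) (s x : Fin d → ℝ) : 0 < mixRatio v q₁ q₂ s x :=
  mix_pos hq₁ (prodRatio_pos v hq₂ s x)

/-- Adding a coordinate multiplies the density by the one of a one-dimensional mixture, whose
rate increases with the density. -/
lemma mixRatio_succ {d : ℕ} (v : NNReal) {q₁ q₂ : ℝ} (hq₁ : q₁ ∈ Set.Icc (0 : ℝ) 1)
    (hq₂ : q₂ ∈ Set.Icc (0 : ℝ) 1) (s : Fin (d + 1) → ℝ) (a : ℝ) (y : Fin d → ℝ) :
    mixRatio v q₁ q₂ s (Fin.cons a y)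
      = mixRatio v q₁ q₂ (fun l => s l.succ) y *
        ((1 - q₂ * (1 - (1 - q₁) / mixRatio v q₁ q₂ (fun l => s l.succ) y)) +
          q₂ * (1 - (1 - q₁) / mixRatio v q₁ q₂ (fun l => s l.succ) y) * shiftRatio v (s 0) a) := by
  have h := mixRatio_pos v hq₁ hq₂ (fun l => s l.succ) y
  have e : q₁ * prodRatio v q₂ (fun l => s l.succ) y
      = mixRatio v q₁ q₂ (fun l => s l.succ) y - (1 - q₁) := by simp [mixRatio]
  have e2 : mixRatio v q₁ q₂ s (Fin.cons a y) = (1 - q₁) +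
      ((1 - q₂) + q₂ * shiftRatio v (s 0) a) * (q₁ * prodRatio v q₂ (fun l => s l.succ) y) := by
    rw [mixRatio, prodRatio_succ]; ring
  rw [e2, e]
  field_simp
  ring

/-- The quotient `(1 - q₁) / mixRatio` is the posterior probability, given the coordinates `y`, that
the vector was not selected. -/
lemma rate_mem {d : ℕ} (v : NNReal) {q₁ q₂ : ℝ} (hq₁ : q₁ ∈ Set.Icc (0 : ℝ) 1)
    (hq₂ : q₂ ∈ Set.Icc (0 : ℝ) 1) (s y : Fin d → ℝ) :
    q₂ * (1 - (1 - q₁) / mixRatio v q₁ q₂ s y) ∈ Set.Icc (0 : ℝ) 1 := by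
  have h := mixRatio_pos v hq₁ hq₂ s y
  have h1 : (1 - q₁) / mixRatio v q₁ q₂ s y ≤ 1 := by
    rw [div_le_one h, mixRatio]
    linarith [mul_nonneg hq₁.1 (prodRatio_pos v hq₂ s y).le]
  have h0 : 0 ≤ (1 - q₁) / mixRatio v q₁ q₂ s y := div_nonneg (by linarith [hq₁.2]) h.le
  exact ⟨mul_nonneg hq₂.1 (by linarith), mul_le_one₀ hq₂.2 (by linarith) (by linarith)⟩

/-- A Chebyshev-type inequality: `V ^ (n + 1) - V⁻¹ ^ n` changes sign at `V = 1`, where the rate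
equals `q₂ * q₁`. Since the rate increases with `V` and `binomExp` with the rate, both differences
have the same sign. The additive form avoids subtraction in `ℝ≥0∞` after integrating. -/
lemma inv_pow_mul_add_le {v : NNReal} (hv : v ≠ 0) (s : ℝ) {q₁ q₂ V : ℝ}
    (hq₁ : q₁ ∈ Set.Icc (0 : ℝ) 1) (hq₂ : q₂ ∈ Set.Icc (0 : ℝ) 1) (hV : 0 < V)
    (hr : q₂ * (1 - (1 - q₁) / V) ∈ Set.Icc (0 : ℝ) 1) (n : ℕ) :
    (V⁻¹) ^ n * binomExp (n + 1) (q₂ * (1 - (1 - q₁) / V)) (s ^ 2 / (2 * v)) +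
        V ^ (n + 1) * binomExp (n + 1) (q₂ * q₁) (s ^ 2 / (2 * v))
      ≤ V ^ (n + 1) * binomExp (n + 1) (q₂ * (1 - (1 - q₁) / V)) (s ^ 2 / (2 * v)) +
        (V⁻¹) ^ n * binomExp (n + 1) (q₂ * q₁) (s ^ 2 / (2 * v)) := by
  have h1 : 0 ≤ 1 - q₁ := by linarith [hq₁.2]
  have h0 := mul_nonneg hq₂.1 hq₁.1
  have h01 : q₂ * q₁ ≤ 1 := mul_le_one₀ hq₂.2 hq₁.1 hq₁.2
  rcases le_total 1 V with h | h
  · have hi : V⁻¹ ≤ 1 := inv_le_one_of_one_le₀ h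
    have a : (V⁻¹) ^ n ≤ V ^ (n + 1) :=
      (pow_le_one₀ (by positivity) hi).trans (one_le_pow₀ h)
    have b : q₂ * q₁ ≤ q₂ * (1 - (1 - q₁) / V) :=
      mul_le_mul_of_nonneg_left (by linarith [div_le_self h1 h]) hq₂.1
    have c := binomExp_mono hv (n + 1) s h0 b hr.2
    nlinarith
  · have hi : 1 ≤ V⁻¹ := (one_le_inv_iff₀).2 ⟨hV, h⟩
    have a : V ^ (n + 1) ≤ (V⁻¹) ^ n :=
      (pow_le_one₀ hV.le h).trans (one_le_pow₀ hi)
    have b : q₂ * (1 - (1 - q₁) / V) ≤ q₂ * q₁ := by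
      refine mul_le_mul_of_nonneg_left ?_ hq₂.1
      have := (le_div_iff₀ hV).2 (mul_le_of_le_one_right h1 h)
      linarith
    have c := binomExp_mono hv (n + 1) s hr.1 b h01
    nlinarith

/-- The removal direction is dominated by the addition direction. -/
theorem lintegral_inv_mixRatio_pow_le {v : NNReal} (hv : v ≠ 0) {q₁ q₂ : ℝ}
    (hq₁ : q₁ ∈ Set.Icc (0 : ℝ) 1) (hq₂ : q₂ ∈ Set.Icc (0 : ℝ) 1) (n : ℕ) {d : ℕ}
    (s : Fin d → ℝ) :
    ∫⁻ x, ENNReal.ofReal (((mixRatio v q₁ q₂ s x)⁻¹) ^ n) ∂(Measure.pi fun _ => gaussianReal 0 v)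
      ≤ ∫⁻ x, ENNReal.ofReal (mixRatio v q₁ q₂ s x ^ (n + 1))
          ∂(Measure.pi fun _ => gaussianReal 0 v) := by
  induction d with
  | zero => simp [mixRatio, prodRatio]
  | succ d ih =>
    have ih' := ih fun l => s l.succ
    -- Finiteness is what permits the final cancellation in `ℝ≥0∞`.
    have hfin : ∫⁻ x, ENNReal.ofReal (mixRatio v q₁ q₂ (fun l => s l.succ) x ^ (n + 1))
        ∂(Measure.pi fun _ : Fin d => gaussianReal 0 v) ≠ ⊤ := by
      simp only [mixRatio]
      rw [lintegral_mix_pow _ hq₁ (by fun_prop) fun x => (prodRatio_pos v hq₂ _ x).le]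
      simp_rw [lintegral_prodRatio_pow hv hq₂]
      exact ENNReal.sum_ne_top.2 fun j _ => ENNReal.mul_ne_top (by simp) (by simp)
    rw [lintegral_pi_succ _ (by fun_prop), lintegral_pi_succ _ (by fun_prop)]
    simp_rw [mixRatio_succ v hq₁ hq₂ s]
    set V : (Fin d → ℝ) → ℝ := mixRatio v q₁ q₂ (fun l => s l.succ) with hVdef
    have hVm : Measurable V := measurable_mixRatio _ _ _ _
    have hV : ∀ y, 0 < V y := mixRatio_pos v hq₁ hq₂ _
    have hr : ∀ y, q₂ * (1 - (1 - q₁) / V y) ∈ Set.Icc (0 : ℝ) 1 := rate_mem v hq₁ hq₂ _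
    set ρ : (Fin d → ℝ) → ℝ := fun y => q₂ * (1 - (1 - q₁) / V y) with hρ
    set t := s 0 ^ 2 / (2 * (v : ℝ)) with ht
    have hq : q₂ * q₁ ∈ Set.Icc (0 : ℝ) 1 :=
      ⟨mul_nonneg hq₂.1 hq₁.1, mul_le_one₀ hq₂.2 hq₁.1 hq₁.2⟩
    have hb : Measurable fun y => binomExp (n + 1) (ρ y) t := by
      unfold binomExp; fun_prop
    have e1 (y : Fin d → ℝ) : ∫⁻ a, ENNReal.ofReal
          ((V y * ((1 - ρ y) + ρ y * shiftRatio v (s 0) a))⁻¹ ^ n) ∂(gaussianReal 0 v)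
        ≤ ENNReal.ofReal ((V y)⁻¹ ^ n * binomExp (n + 1) (ρ y) t) := by
      have := (hV y).le
      simp_rw [mul_inv, mul_pow]
      rw [ENNReal.ofReal_mul (by positivity)]
      simp_rw [ENNReal.ofReal_mul (show 0 ≤ (V y)⁻¹ ^ n by positivity)]
      rw [lintegral_const_mul _ (by fun_prop)]
      exact mul_le_mul_right (lintegral_inv_mix_shiftRatio_pow_le hv (hr y) (s 0) n) _
    have e2 (y : Fin d → ℝ) : ∫⁻ a, ENNReal.ofReal
          ((V y * ((1 - ρ y) + ρ y * shiftRatio v (s 0) a)) ^ (n + 1)) ∂(gaussianReal 0 v)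
        = ENNReal.ofReal (V y ^ (n + 1) * binomExp (n + 1) (ρ y) t) := by
      have := (hV y).le
      simp_rw [mul_pow]
      rw [ENNReal.ofReal_mul (by positivity)]
      simp_rw [ENNReal.ofReal_mul (show 0 ≤ V y ^ (n + 1) by positivity)]
      rw [lintegral_const_mul _ (by fun_prop), lintegral_mix_shiftRatio_pow hv (hr y)]
    refine (lintegral_mono e1).trans (le_trans ?_ (lintegral_congr e2).ge)
    -- The value at `V = 1` is a constant, so it factors out of the integrals and leaves the
    -- induction hypothesis.
    set B := binomExp (n + 1) (q₂ * q₁) t with hB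
    have hB0 : 0 < B := binomExp_pos _ hq _
    have main : (∫⁻ y, ENNReal.ofReal ((V y)⁻¹ ^ n * binomExp (n + 1) (ρ y) t)
          ∂(Measure.pi fun _ => gaussianReal 0 v)) +
        ∫⁻ y, ENNReal.ofReal (V y ^ (n + 1) * B) ∂(Measure.pi fun _ => gaussianReal 0 v)
        ≤ (∫⁻ y, ENNReal.ofReal (V y ^ (n + 1) * binomExp (n + 1) (ρ y) t)
          ∂(Measure.pi fun _ => gaussianReal 0 v)) +
        ∫⁻ y, ENNReal.ofReal ((V y)⁻¹ ^ n * B) ∂(Measure.pi fun _ => gaussianReal 0 v) := by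
      rw [← lintegral_add_left (by fun_prop), ← lintegral_add_left (by fun_prop)]
      refine lintegral_mono fun y => ?_
      have hy := hV y
      have hby := (binomExp_pos (n + 1) (hr y) t).le
      rw [← ENNReal.ofReal_add (by positivity) (by positivity),
        ← ENNReal.ofReal_add (by positivity) (by positivity)]
      exact ENNReal.ofReal_le_ofReal (inv_pow_mul_add_le hv (s 0) hq₁ hq₂ hy (hr y) n)
    have hle : ∫⁻ y, ENNReal.ofReal ((V y)⁻¹ ^ n * B) ∂(Measure.pi fun _ => gaussianReal 0 v)
        ≤ ∫⁻ y, ENNReal.ofReal (V y ^ (n + 1) * B) ∂(Measure.pi fun _ => gaussianReal 0 v) := by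
      simp_rw [ENNReal.ofReal_mul' hB0.le]
      rw [lintegral_mul_const _ (by fun_prop), lintegral_mul_const _ (by fun_prop)]
      exact mul_le_mul_left ih' _
    have hfin' : ∫⁻ y, ENNReal.ofReal (V y ^ (n + 1) * B)
        ∂(Measure.pi fun _ => gaussianReal 0 v) ≠ ⊤ := by
      simp_rw [ENNReal.ofReal_mul' hB0.le]
      rw [lintegral_mul_const _ (by fun_prop)]
      exact ENNReal.mul_ne_top hfin (by simp)
    exact (ENNReal.add_le_add_iff_right hfin').1 (main.trans (add_le_add_right hle _))

/-! ### Rényi divergence of measures with densities -/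

lemma renyiDiv_withDensity_le {Ω : Type*} [MeasurableSpace Ω] (μ : Measure Ω) [SigmaFinite μ]
    {f g : Ω → ℝ} (hf : Measurable f) (hg : Measurable g) (hf0 : ∀ x, 0 ≤ f x) (hg0 : ∀ x, 0 < g x)
    {n : ℕ} {B : ℝ} (hB : 0 < B)
    (h : ∫⁻ x, ENNReal.ofReal (f x ^ (n + 1) * (g x)⁻¹ ^ n) ∂μ ≤ ENNReal.ofReal B) :
    renyiDiv ((n + 1 : ℕ) : ℝ) (μ.withDensity fun x => ENNReal.ofReal (f x))
        (μ.withDensity fun x => ENNReal.ofReal (g x))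
      ≤ ((Real.log B / (((n + 1 : ℕ) : ℝ) - 1) : ℝ) : EReal) := by
  set Q := μ.withDensity fun x => ENNReal.ofReal (g x) with hQ
  have hPQ : (μ.withDensity fun x => ENNReal.ofReal (f x))
      = Q.withDensity fun x => ENNReal.ofReal (f x / g x) := by
    rw [hQ, ← withDensity_mul _ (by fun_prop) (by fun_prop)]
    congr 1
    ext x
    rw [Pi.mul_apply, ← ENNReal.ofReal_mul (hg0 x).le, mul_div_cancel₀ _ (hg0 x).ne']
  have hac : Q.withDensity (fun x => ENNReal.ofReal (f x / g x)) ≪ Q :=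
    withDensity_absolutelyContinuous _ _
  rw [hPQ, renyiDiv, if_pos hac]
  have hint : ∫⁻ x, ((Q.withDensity fun x => ENNReal.ofReal (f x / g x)).rnDeriv Q x) ^
      ((n + 1 : ℕ) : ℝ) ∂Q ≤ ENNReal.ofReal B := by
    have e : ∫⁻ x, ((Q.withDensity fun x => ENNReal.ofReal (f x / g x)).rnDeriv Q x) ^
        ((n + 1 : ℕ) : ℝ) ∂Q = ∫⁻ x, ENNReal.ofReal (f x / g x) ^ (n + 1) ∂Q := by
      refine lintegral_congr_ae ?_
      filter_upwards [Measure.rnDeriv_withDensity Q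
        (f := fun x => ENNReal.ofReal (f x / g x)) (by fun_prop)] with x hx
      rw [hx, ENNReal.rpow_natCast]
    rw [e, hQ, lintegral_withDensity_eq_lintegral_mul _ (by fun_prop) (by fun_prop)]
    refine le_trans (le_of_eq (lintegral_congr fun x => ?_)) h
    have hx := hg0 x
    rw [Pi.mul_apply, ← ENNReal.ofReal_pow (div_nonneg (hf0 x) hx.le),
      ← ENNReal.ofReal_mul hx.le]
    congr 1
    rw [div_pow, inv_pow, pow_succ (g x)]
    field_simp
  have hlog := ENNReal.log_le_log hint
  rw [ENNReal.log_ofReal_of_pos hB] at hlog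
  have hn : 0 ≤ (((n + 1 : ℕ) : ℝ) - 1)⁻¹ := by push_cast; simp
  calc _ ≤ ((((((n + 1 : ℕ) : ℝ) - 1)⁻¹ : ℝ) : EReal)) * ((Real.log B : ℝ) : EReal) :=
        mul_le_mul_of_nonneg_left hlog (by exact_mod_cast hn)
    _ = _ := by rw [← EReal.coe_mul]; congr 1; ring

/-- Joint convexity of the perspective function `(b, a) ↦ b ^ (n + 1) / a ^ n`. -/
lemma sum_pow_mul_inv_pow_le {κ : Type*} (K : Finset κ) {w a b : κ → ℝ} (hw : ∀ k ∈ K, 0 ≤ w k)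
    (ha : ∀ k ∈ K, 0 < a k) (hb : ∀ k ∈ K, 0 ≤ b k) (hA : 0 < ∑ k ∈ K, w k * a k) (n : ℕ) :
    (∑ k ∈ K, w k * b k) ^ (n + 1) * (∑ k ∈ K, w k * a k)⁻¹ ^ n
      ≤ ∑ k ∈ K, w k * (b k ^ (n + 1) * (a k)⁻¹ ^ n) := by
  set A := ∑ k ∈ K, w k * a k with hAdef
  -- Jensen's inequality at the points `b k / a k`, with the weights tilted by `a k`.
  have h := (convexOn_pow (𝕜 := ℝ) (n + 1)).map_sum_le (t := K) (w := fun k => w k * a k / A)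
    (p := fun k => b k / a k)
    (fun k hk => div_nonneg (mul_nonneg (hw k hk) (ha k hk).le) hA.le)
    (by rw [← Finset.sum_div, ← hAdef, div_self hA.ne'])
    (fun k hk => Set.mem_Ici.2 (div_nonneg (hb k hk) (ha k hk).le))
  simp only [smul_eq_mul] at h
  have e1 : ∑ k ∈ K, w k * a k / A * (b k / a k) = (∑ k ∈ K, w k * b k) / A := by
    rw [Finset.sum_div]
    refine Finset.sum_congr rfl fun k hk => ?_
    have := (ha k hk).ne'
    field_simp
  have e2 : ∑ k ∈ K, w k * a k / A * (b k / a k) ^ (n + 1)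
      = (∑ k ∈ K, w k * (b k ^ (n + 1) * (a k)⁻¹ ^ n)) / A := by
    rw [Finset.sum_div]
    refine Finset.sum_congr rfl fun k hk => ?_
    have := (ha k hk).ne'
    rw [div_pow, inv_pow, pow_succ (a k)]
    field_simp
  rw [e1, e2, le_div_iff₀ hA] at h
  refine le_trans (le_of_eq ?_) h
  rw [div_pow, inv_pow, pow_succ A]
  field_simp

lemma sum_mul_pos {κ : Type*} (K : Finset κ) {w a : κ → ℝ} (hw : ∀ k ∈ K, 0 ≤ w k)
    (hw1 : ∑ k ∈ K, w k = 1) (ha : ∀ k ∈ K, 0 < a k) : 0 < ∑ k ∈ K, w k * a k := by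
  have h0 : ∀ k ∈ K, 0 ≤ w k * a k := fun k hk => mul_nonneg (hw k hk) (ha k hk).le
  refine (Finset.sum_nonneg h0).lt_of_ne' fun h => ?_
  have h1 := (Finset.sum_eq_zero_iff_of_nonneg h0).1 h
  have : ∑ k ∈ K, w k = 0 := Finset.sum_eq_zero fun k hk =>
    (mul_eq_zero.1 (h1 k hk)).resolve_right (ha k hk).ne'
  linarith

/-- Quasi-convexity of the Rényi divergence, for mixtures of translates. -/
lemma lintegral_mixture_translates_le {d : ℕ} {κ : Type*} (K : Finset κ) {w : κ → ℝ}
    (m : κ → Fin d → ℝ) {a b : (Fin d → ℝ) → ℝ} (ham : Measurable a) (hbm : Measurable b)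
    (hw : ∀ k ∈ K, 0 ≤ w k) (hw1 : ∑ k ∈ K, w k = 1) (ha : ∀ x, 0 < a x) (hb : ∀ x, 0 ≤ b x)
    (n : ℕ) :
    ∫⁻ x, ENNReal.ofReal
        ((∑ k ∈ K, w k * b (x - m k)) ^ (n + 1) * (∑ k ∈ K, w k * a (x - m k))⁻¹ ^ n)
      ≤ ∫⁻ x, ENNReal.ofReal (b x ^ (n + 1) * (a x)⁻¹ ^ n) := by
  have hc0 : ∀ x, 0 ≤ b x ^ (n + 1) * (a x)⁻¹ ^ n := fun x => by
    have := ha x; have := hb x; positivity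
  calc _ ≤ ∫⁻ x, ∑ k ∈ K, ENNReal.ofReal (w k) *
          ENNReal.ofReal (b (x - m k) ^ (n + 1) * (a (x - m k))⁻¹ ^ n) := by
        refine lintegral_mono fun x => ?_
        refine (ENNReal.ofReal_le_ofReal (sum_pow_mul_inv_pow_le K hw (fun k _ => ha _)
          (fun k _ => hb _) (sum_mul_pos K hw hw1 fun k _ => ha _) n)).trans (le_of_eq ?_)
        rw [ENNReal.ofReal_sum_of_nonneg fun k hk => mul_nonneg (hw k hk) (hc0 _)]
        exact Finset.sum_congr rfl fun k hk => ENNReal.ofReal_mul (hw k hk)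
    _ = ∑ k ∈ K, ENNReal.ofReal (w k) * ∫⁻ x, ENNReal.ofReal (b x ^ (n + 1) * (a x)⁻¹ ^ n) := by
        rw [lintegral_finsetSum _ fun k _ => by fun_prop]
        refine Finset.sum_congr rfl fun k _ => ?_
        rw [lintegral_const_mul _ (by fun_prop),
          lintegral_sub_right_eq_self (fun x => ENNReal.ofReal (b x ^ (n + 1) * (a x)⁻¹ ^ n)) (m k)]
    _ = _ := by
        rw [← Finset.sum_mul, ← ENNReal.ofReal_sum_of_nonneg hw, hw1, ENNReal.ofReal_one, one_mul]

/-! ### Poisson sampling -/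

lemma sum_powerset_map {ι κ M : Type*} [DecidableEq κ] [AddCommMonoid M] (e : ι ↪ κ) (I : Finset ι)
    (f : Finset κ → M) : ∑ J ∈ (I.map e).powerset, f J = ∑ J ∈ I.powerset, f (J.map e) := by
  have : (I.map e).powerset = I.powerset.map (Finset.mapEmbedding e).toEmbedding := by
    ext J
    simp only [Finset.mem_powerset, Finset.mem_map, Finset.subset_map_iff]
    exact ⟨fun ⟨u, h, h'⟩ => ⟨u, h, h'.symm⟩, fun ⟨u, h, h'⟩ => ⟨u, h, h'.symm⟩⟩
  rw [this, Finset.sum_map]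
  rfl

section Sampling

variable {ι : Type*} [DecidableEq ι]

lemma sampleProb_nonneg {q : ℝ} (hq : q ∈ Set.Icc (0 : ℝ) 1) (I J : Finset ι) :
    0 ≤ sampleProb q I J := by
  have h1q : 0 ≤ 1 - q := by linarith [hq.2]
  have hq0 := hq.1
  unfold sampleProb; positivity

lemma sum_sampleProb (q : ℝ) (I : Finset ι) : ∑ J ∈ I.powerset, sampleProb q I J = 1 := by
  have := Finset.sum_pow_mul_eq_add_pow q (1 - q) I
  rw [add_sub_cancel, one_pow] at this
  rw [← this]
  refine Finset.sum_congr rfl fun J hJ => ?_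
  rw [sampleProb, Finset.card_sdiff_of_subset (Finset.mem_powerset.1 hJ)]

lemma sampleProb_insert_left {a : ι} {I J : Finset ι} (ha : a ∉ I) (hJ : J ⊆ I) (q : ℝ) :
    sampleProb q (insert a I) J = (1 - q) * sampleProb q I J := by
  rw [sampleProb, sampleProb, Finset.insert_sdiff_of_notMem _ fun h => ha (hJ h),
    Finset.card_insert_of_notMem (by simp [ha])]
  ring

lemma sampleProb_insert_insert {a : ι} {I J : Finset ι} (ha : a ∉ I) (hJ : J ⊆ I) (q : ℝ) :
    sampleProb q (insert a I) (insert a J) = q * sampleProb q I J := by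
  rw [sampleProb, sampleProb, Finset.card_insert_of_notMem fun h => ha (hJ h),
    Finset.insert_sdiff_insert, Finset.sdiff_insert_of_notMem ha]
  ring

/-- Conditioning on whether `a` is drawn; used for both the outer and the coordinate-wise sampling.
-/
lemma sum_sampleProb_insert {M : Type*} [AddCommMonoid M] [Module ℝ M] {a : ι} {I : Finset ι}
    (ha : a ∉ I) (q : ℝ) (f : Finset ι → M) :
    ∑ J ∈ (insert a I).powerset, sampleProb q (insert a I) J • f J
      = ∑ J ∈ I.powerset, sampleProb q I J • ((1 - q) • f J + q • f (insert a J)) := by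
  rw [Finset.sum_powerset_insert ha, ← Finset.sum_add_distrib]
  refine Finset.sum_congr rfl fun J hJ => ?_
  have hJ' := Finset.mem_powerset.1 hJ
  rw [sampleProb_insert_left ha hJ', sampleProb_insert_insert ha hJ', smul_add, smul_smul,
    smul_smul, mul_comm, mul_comm q]

lemma sampleProb_map {κ : Type*} [DecidableEq κ] (e : ι ↪ κ) (q : ℝ) (I J : Finset ι) :
    sampleProb q (I.map e) (J.map e) = sampleProb q I J := by
  rw [sampleProb, sampleProb, ← Finset.map_sdiff, Finset.card_map, Finset.card_map]

/-! ### Laws and densities -/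

variable {d : ℕ}

/-- The law of twice sampling from the vectors `y i`, `i ∈ T`. -/
def twiceLaw (q₁ q₂ σ : ℝ) (y : ι → Fin d → ℝ) (T : Finset ι) : Measure (Fin d → ℝ) :=
  ∑ I ∈ T.powerset, ENNReal.ofReal (sampleProb q₁ T I) • coordinateSampling q₂ σ y I

lemma twiceLaw_map {κ : Type*} [DecidableEq κ] (e : ι ↪ κ) (q₁ q₂ σ : ℝ) (y : κ → Fin d → ℝ)
    (T : Finset ι) : twiceLaw q₁ q₂ σ y (T.map e) = twiceLaw q₁ q₂ σ (y ∘ e) T := by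
  simp only [twiceLaw, coordinateSampling, coordinateLaw, sum_powerset_map, sampleProb_map,
    Finset.sum_map, Function.comp_apply]

/-- The density of `coordinateLaw`. -/
def coordDensity (v : NNReal) (q : ℝ) (y : ι → Fin d → ℝ) (I : Finset ι) (l : Fin d) (x : ℝ) : ℝ :=
  ∑ J ∈ I.powerset, sampleProb q I J * gaussianPDFReal (∑ i ∈ J, y i l) v x

@[fun_prop]
lemma measurable_coordDensity (v : NNReal) (q : ℝ) (y : ι → Fin d → ℝ) (I : Finset ι) (l : Fin d) :
    Measurable (coordDensity v q y I l) :=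
  Finset.measurable_fun_sum _ fun _ _ => (measurable_gaussianPDFReal _ _).const_mul _

lemma coordDensity_nonneg (v : NNReal) {q : ℝ} (hq : q ∈ Set.Icc (0 : ℝ) 1) (y : ι → Fin d → ℝ)
    (I : Finset ι) (l : Fin d) (x : ℝ) : 0 ≤ coordDensity v q y I l x :=
  Finset.sum_nonneg fun _ _ => mul_nonneg (sampleProb_nonneg hq _ _) (gaussianPDFReal_nonneg _ _ _)

/-- The density of `twiceLaw`. -/
def twiceDensity (v : NNReal) (q₁ q₂ : ℝ) (y : ι → Fin d → ℝ) (T : Finset ι) (x : Fin d → ℝ) : ℝ :=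
  ∑ I ∈ T.powerset, sampleProb q₁ T I * ∏ l, coordDensity v q₂ y I l (x l)

lemma sum_ofReal_smul_withDensity {Ω κ : Type*} [MeasurableSpace Ω] (μ : Measure Ω) (K : Finset κ)
    {w : κ → ℝ} {f : κ → Ω → ℝ} (hw : ∀ k ∈ K, 0 ≤ w k) (hf : ∀ k, Measurable (f k))
    (hf0 : ∀ k x, 0 ≤ f k x) :
    ∑ k ∈ K, ENNReal.ofReal (w k) • μ.withDensity (fun x => ENNReal.ofReal (f k x))
      = μ.withDensity fun x => ENNReal.ofReal (∑ k ∈ K, w k * f k x) := by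
  ext s hs
  rw [withDensity_apply _ hs, Measure.finsetSum_apply]
  simp only [Measure.smul_apply, smul_eq_mul, withDensity_apply _ hs]
  have : ∀ x, ENNReal.ofReal (∑ k ∈ K, w k * f k x)
      = ∑ k ∈ K, ENNReal.ofReal (w k) * ENNReal.ofReal (f k x) := fun x => by
    rw [ENNReal.ofReal_sum_of_nonneg fun k hk => mul_nonneg (hw k hk) (hf0 k x)]
    exact Finset.sum_congr rfl fun k hk => ENNReal.ofReal_mul (hw k hk)
  simp_rw [this]
  rw [lintegral_finsetSum _ fun k _ => by have := hf k; fun_prop]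
  exact Finset.sum_congr rfl fun k _ => (lintegral_const_mul _ (by have := hf k; fun_prop)).symm

lemma coordinateLaw_eq {q σ : ℝ} (hq : q ∈ Set.Icc (0 : ℝ) 1) (hv : Real.toNNReal (σ ^ 2) ≠ 0)
    (y : ι → Fin d → ℝ) (I : Finset ι) (l : Fin d) :
    coordinateLaw q σ y I l = (volume : Measure ℝ).withDensity fun x =>
      ENNReal.ofReal (coordDensity (Real.toNNReal (σ ^ 2)) q y I l x) := by
  rw [coordinateLaw]
  simp_rw [gaussianReal_of_var_ne_zero _ hv, gaussianPDF_def]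
  exact sum_ofReal_smul_withDensity _ _ (fun J _ => sampleProb_nonneg hq _ _)
    (fun J => measurable_gaussianPDFReal _ _) (fun J x => gaussianPDFReal_nonneg _ _ _)

lemma coordinateSampling_eq {q σ : ℝ} (hq : q ∈ Set.Icc (0 : ℝ) 1)
    (hv : Real.toNNReal (σ ^ 2) ≠ 0) (y : ι → Fin d → ℝ) (I : Finset ι) :
    coordinateSampling q σ y I = (volume : Measure (Fin d → ℝ)).withDensity fun x =>
      ENNReal.ofReal (∏ l, coordDensity (Real.toNNReal (σ ^ 2)) q y I l (x l)) := by
  rw [coordinateSampling]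
  simp_rw [coordinateLaw_eq hq hv]
  rw [pi_withDensity fun l => by fun_prop]
  congr 1
  ext x
  rw [ENNReal.ofReal_prod_of_nonneg fun l _ => coordDensity_nonneg _ hq _ _ _ _]

lemma twiceLaw_eq {q₁ q₂ σ : ℝ} (hq₁ : q₁ ∈ Set.Icc (0 : ℝ) 1) (hq₂ : q₂ ∈ Set.Icc (0 : ℝ) 1)
    (hv : Real.toNNReal (σ ^ 2) ≠ 0) (y : ι → Fin d → ℝ) (T : Finset ι) :
    twiceLaw q₁ q₂ σ y T = (volume : Measure (Fin d → ℝ)).withDensity fun x =>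
      ENNReal.ofReal (twiceDensity (Real.toNNReal (σ ^ 2)) q₁ q₂ y T x) := by
  rw [twiceLaw]
  simp_rw [coordinateSampling_eq hq₂ hv]
  exact sum_ofReal_smul_withDensity _ _ (fun I _ => sampleProb_nonneg hq₁ _ _)
    (fun I => by fun_prop)
    (fun I x => Finset.prod_nonneg fun l _ => coordDensity_nonneg _ hq₂ _ _ _ _)

/-- The density of the centred Gaussian law on `Fin d → ℝ`. -/
def stdDensity (v : NNReal) (x : Fin d → ℝ) : ℝ := ∏ l, gaussianPDFReal 0 v (x l)

@[fun_prop]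
lemma measurable_stdDensity (v : NNReal) : Measurable (stdDensity (d := d) v) :=
  Finset.measurable_fun_prod _ fun l _ =>
    (measurable_gaussianPDFReal 0 v).comp (measurable_pi_apply l)

lemma stdDensity_pos {v : NNReal} (hv : v ≠ 0) (x : Fin d → ℝ) : 0 < stdDensity v x :=
  Finset.prod_pos fun _ _ => gaussianPDFReal_pos _ _ _ hv

lemma pi_gaussianReal_eq {v : NNReal} (hv : v ≠ 0) :
    Measure.pi (fun _ : Fin d => gaussianReal 0 v)
      = (volume : Measure (Fin d → ℝ)).withDensity fun x => ENNReal.ofReal (stdDensity v x) := by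
  have : SigmaFinite ((volume : Measure ℝ).withDensity (gaussianPDF 0 v)) := by
    rw [← gaussianReal_of_var_ne_zero 0 hv]; infer_instance
  simp_rw [gaussianReal_of_var_ne_zero _ hv]
  rw [pi_withDensity fun l => measurable_gaussianPDF 0 v]
  congr 1
  ext x
  rw [stdDensity, ENNReal.ofReal_prod_of_nonneg fun l _ => gaussianPDFReal_nonneg _ _ _]
  rfl

lemma prod_coordDensity_eq (v : NNReal) (q : ℝ) (y : ι → Fin d → ℝ) (I : Finset ι)
    (x : Fin d → ℝ) :
    ∏ l, coordDensity v q y I l (x l)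
      = ∑ J ∈ Fintype.piFinset fun _ : Fin d => I.powerset,
          (∏ l, sampleProb q I (J l)) * stdDensity v (x - fun l => ∑ i ∈ J l, y i l) := by
  simp only [coordDensity]
  rw [Finset.prod_univ_sum]
  refine Finset.sum_congr rfl fun J _ => ?_
  rw [stdDensity, ← Finset.prod_mul_distrib]
  refine Finset.prod_congr rfl fun l _ => ?_
  rw [Pi.sub_apply, gaussianPDFReal_sub, zero_add]

/-- The sum runs over the choices for `I` alone, with the same weights and translations as in
`prod_coordDensity_eq`; the sampling of `a` is absorbed into `prodRatio`. -/
lemma prod_coordDensity_insert {v : NNReal} (hv : v ≠ 0) (q : ℝ) (y : ι → Fin d → ℝ) {a : ι}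
    {I : Finset ι} (ha : a ∉ I) (x : Fin d → ℝ) :
    ∏ l, coordDensity v q y (insert a I) l (x l)
      = ∑ J ∈ Fintype.piFinset fun _ : Fin d => I.powerset,
          (∏ l, sampleProb q I (J l)) * (stdDensity v (x - fun l => ∑ i ∈ J l, y i l) *
            prodRatio v q (y a) (x - fun l => ∑ i ∈ J l, y i l)) := by
  have e (l : Fin d) : coordDensity v q y (insert a I) l (x l)
      = ∑ J ∈ I.powerset, sampleProb q I J * (gaussianPDFReal 0 v (x l - ∑ i ∈ J, y i l) *
          ((1 - q) + q * shiftRatio v (y a l) (x l - ∑ i ∈ J, y i l))) := by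
    have := sum_sampleProb_insert ha q fun J => gaussianPDFReal (∑ i ∈ J, y i l) v (x l)
    simp only [smul_eq_mul] at this
    rw [coordDensity, this]
    refine Finset.sum_congr rfl fun J hJ => ?_
    rw [Finset.sum_insert fun h => ha (Finset.mem_powerset.1 hJ h)]
    have h1 := gaussianPDFReal_sub (μ := 0) (v := v) (x l) (∑ i ∈ J, y i l)
    have h2 := gaussianPDFReal_sub (μ := y a l) (v := v) (x l) (∑ i ∈ J, y i l)
    rw [zero_add] at h1
    rw [← h1, ← h2, ← shiftRatio_mul_gaussianPDFReal hv (y a l)]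
    ring
  simp only [e]
  rw [Finset.prod_univ_sum]
  refine Finset.sum_congr rfl fun J _ => ?_
  rw [stdDensity, prodRatio, ← Finset.prod_mul_distrib, ← Finset.prod_mul_distrib]
  rfl

/-- Datasets that differ in one point yield, with common weights, mixtures of translates of the
centred Gaussian density and of its product with `mixRatio`. -/
lemma exists_mixture {v : NNReal} (hv : v ≠ 0) {q₁ q₂ : ℝ} (hq₁ : q₁ ∈ Set.Icc (0 : ℝ) 1)
    (hq₂ : q₂ ∈ Set.Icc (0 : ℝ) 1) (y : ι → Fin d → ℝ) {a : ι} {T : Finset ι} (ha : a ∉ T) :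
    ∃ (K : Finset (Σ _ : Finset ι, Fin d → Finset ι)) (w : (Σ _ : Finset ι, Fin d → Finset ι) → ℝ)
      (m : (Σ _ : Finset ι, Fin d → Finset ι) → Fin d → ℝ),
      (∀ k ∈ K, 0 ≤ w k) ∧ ∑ k ∈ K, w k = 1 ∧
      (∀ x, twiceDensity v q₁ q₂ y T x = ∑ k ∈ K, w k * stdDensity v (x - m k)) ∧
      ∀ x, twiceDensity v q₁ q₂ y (insert a T) x
        = ∑ k ∈ K, w k * (stdDensity v (x - m k) * mixRatio v q₁ q₂ (y a) (x - m k)) := by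
  -- An index records all choices for the common points: the outer subset and one further subset per
  -- coordinate.
  refine ⟨T.powerset.sigma fun I => Fintype.piFinset fun _ : Fin d => I.powerset,
    fun k => sampleProb q₁ T k.1 * ∏ l, sampleProb q₂ k.1 (k.2 l),
    fun k l => ∑ i ∈ k.2 l, y i l, fun k _ => ?_, ?_, fun x => ?_, fun x => ?_⟩
  · exact mul_nonneg (sampleProb_nonneg hq₁ _ _)
      (Finset.prod_nonneg fun l _ => sampleProb_nonneg hq₂ _ _)
  · rw [Finset.sum_sigma, ← sum_sampleProb q₁ T]
    refine Finset.sum_congr rfl fun I _ => ?_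
    dsimp only
    rw [← Finset.mul_sum, ← Finset.prod_univ_sum (fun _ : Fin d => I.powerset)
      fun _ J => sampleProb q₂ I J]
    simp [sum_sampleProb]
  · rw [twiceDensity, Finset.sum_sigma]
    refine Finset.sum_congr rfl fun I _ => ?_
    rw [prod_coordDensity_eq, Finset.mul_sum]
    exact Finset.sum_congr rfl fun J _ => by ring
  · have := sum_sampleProb_insert ha q₁ fun I => ∏ l, coordDensity v q₂ y I l (x l)
    simp only [smul_eq_mul] at this
    rw [twiceDensity, this, Finset.sum_sigma]
    refine Finset.sum_congr rfl fun I hI => ?_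
    rw [prod_coordDensity_eq, prod_coordDensity_insert hv q₂ y
      fun h => ha (Finset.mem_powerset.1 hI h)]
    simp only [Finset.mul_sum, ← Finset.sum_add_distrib, mixRatio]
    exact Finset.sum_congr rfl fun J _ => by ring

lemma measurable_twiceDensity (v : NNReal) (q₁ q₂ : ℝ) (y : ι → Fin d → ℝ) (T : Finset ι) :
    Measurable (twiceDensity v q₁ q₂ y T) := by
  unfold twiceDensity; fun_prop

/-- Adding or removing one vector changes the Rényi divergence by at most the divergence of the
mixture of that vector alone from the centred Gaussian law. -/
theorem renyiDiv_twiceLaw_insert_le {q₁ q₂ σ : ℝ} (hq₁ : q₁ ∈ Set.Icc (0 : ℝ) 1)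
    (hq₂ : q₂ ∈ Set.Icc (0 : ℝ) 1) (hσ : 0 < σ) (y : ι → Fin d → ℝ) {a : ι} {T : Finset ι}
    (ha : a ∉ T) {n : ℕ} {B : ℝ} (hB : 0 < B)
    (h : ∫⁻ x, ENNReal.ofReal (mixRatio (Real.toNNReal (σ ^ 2)) q₁ q₂ (y a) x ^ (n + 1))
      ∂(Measure.pi fun _ => gaussianReal 0 (Real.toNNReal (σ ^ 2))) ≤ ENNReal.ofReal B) :
    renyiDiv ((n + 1 : ℕ) : ℝ) (twiceLaw q₁ q₂ σ y (insert a T)) (twiceLaw q₁ q₂ σ y T)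
        ≤ ((Real.log B / (((n + 1 : ℕ) : ℝ) - 1) : ℝ) : EReal) ∧
      renyiDiv ((n + 1 : ℕ) : ℝ) (twiceLaw q₁ q₂ σ y T) (twiceLaw q₁ q₂ σ y (insert a T))
        ≤ ((Real.log B / (((n + 1 : ℕ) : ℝ) - 1) : ℝ) : EReal) := by
  have hv : Real.toNNReal (σ ^ 2) ≠ 0 := by simpa using hσ.ne'
  rw [twiceLaw_eq hq₁ hq₂ hv, twiceLaw_eq hq₁ hq₂ hv]
  have h' := (lintegral_inv_mixRatio_pow_le hv hq₁ hq₂ n (y a)).trans h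
  set v := Real.toNNReal (σ ^ 2)
  obtain ⟨K, w, m, hw, hw1, hf, hg⟩ := exists_mixture hv hq₁ hq₂ y ha
  have hW := mixRatio_pos v hq₁ hq₂ (y a)
  have hS := stdDensity_pos (d := d) hv
  have hSW : ∀ x, 0 < stdDensity v x * mixRatio v q₁ q₂ (y a) x := fun x => mul_pos (hS x) (hW x)
  have hf0 : ∀ x, 0 < twiceDensity v q₁ q₂ y T x := fun x => by
    rw [hf]; exact sum_mul_pos K hw hw1 fun k _ => hS _
  have hg0 : ∀ x, 0 < twiceDensity v q₁ q₂ y (insert a T) x := fun x => by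
    rw [hg]; exact sum_mul_pos K hw hw1 fun k _ => hSW _
  have toStd : ∀ F : (Fin d → ℝ) → ℝ, Measurable F →
      ∫⁻ x, ENNReal.ofReal (F x) ∂(Measure.pi fun _ => gaussianReal 0 v)
        = ∫⁻ x, ENNReal.ofReal (stdDensity v x * F x) := fun F hF => by
    rw [pi_gaussianReal_eq hv, lintegral_withDensity_eq_lintegral_mul _ (by fun_prop) (by fun_prop)]
    exact lintegral_congr fun x => by rw [Pi.mul_apply, ← ENNReal.ofReal_mul (hS x).le]
  constructor
  · refine renyiDiv_withDensity_le _ (measurable_twiceDensity _ _ _ _ _)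
      (measurable_twiceDensity _ _ _ _ _) (fun x => (hg0 x).le) hf0 hB ?_
    simp_rw [hf, hg]
    -- With numerator `S W` and denominator `S`, the integrand becomes `S W ^ (n + 1)`; exchanging
    -- the roles below gives `S W⁻¹ ^ n`.
    refine (lintegral_mixture_translates_le K m (a := stdDensity v)
      (b := fun x => stdDensity v x * mixRatio v q₁ q₂ (y a) x) (by fun_prop) (by fun_prop) hw hw1
      hS (fun x => (hSW x).le) n).trans (le_trans (le_of_eq ?_) h)
    rw [toStd _ (by fun_prop)]
    refine lintegral_congr fun x => congrArg _ ?_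
    have := (hS x).ne'
    rw [mul_pow, inv_pow, pow_succ (stdDensity v x)]
    field_simp
  · refine renyiDiv_withDensity_le _ (measurable_twiceDensity _ _ _ _ _)
      (measurable_twiceDensity _ _ _ _ _) (fun x => (hf0 x).le) hg0 hB ?_
    simp_rw [hf, hg]
    refine (lintegral_mixture_translates_le K m (b := stdDensity v)
      (a := fun x => stdDensity v x * mixRatio v q₁ q₂ (y a) x) (by fun_prop) (by fun_prop) hw hw1
      hSW (fun x => (hS x).le) n).trans (le_trans (le_of_eq ?_) h')
    rw [toStd _ (by fun_prop)]
    refine lintegral_congr fun x => congrArg _ ?_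
    have := (hS x).ne'
    rw [mul_inv, mul_pow, inv_pow (stdDensity v x), pow_succ (stdDensity v x)]
    field_simp

end Sampling

/-! ### Datasets as lists -/

lemma exists_equiv_of_perm {𝒳 : Type*} {X Y : List 𝒳} (h : X.Perm Y) :
    ∃ e : Fin X.length ≃ Fin Y.length, ∀ i, Y.get (e i) = X.get i := by
  induction h with
  | nil => exact ⟨Equiv.refl _, fun _ => rfl⟩
  | @cons x X Y _ ih =>
    obtain ⟨e, he⟩ := ih
    refine ⟨(finSuccEquiv X.length).trans (e.optionCongr.trans (finSuccEquiv Y.length).symm),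
      fun i => ?_⟩
    refine Fin.cases ?_ (fun j => ?_) i
    · simp
    · simpa using he j
  | swap x y X =>
    refine ⟨Equiv.swap (0 : Fin (X.length + 2)) 1, fun i => ?_⟩
    refine Fin.cases ?_ (fun j => Fin.cases ?_ (fun k => ?_) j) i
    · simp
    · have : (Fin.succ 0 : Fin (X.length + 2)) = 1 := rfl
      simp [this]
    · have h0 : (k.succ.succ : Fin (X.length + 2)) ≠ 0 := Fin.succ_ne_zero _
      have h1 : (k.succ.succ : Fin (X.length + 2)) ≠ 1 := by
        simp [Fin.ext_iff]
      rw [Equiv.swap_apply_of_ne_of_ne h0 h1]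
      simp
  | trans _ _ ih₁ ih₂ =>
    obtain ⟨e₁, h₁⟩ := ih₁
    obtain ⟨e₂, h₂⟩ := ih₂
    exact ⟨e₁.trans e₂, fun i => by rw [Equiv.trans_apply, h₂, h₁]⟩

section Lists

variable {𝒳 : Type*} {d : ℕ} (q₁ q₂ σ : ℝ) (CP : (Fin d → ℝ) → (Fin d → ℝ)) (F : 𝒳 → Fin d → ℝ)

lemma twiceSampling_eq (X : List 𝒳) :
    twiceSampling q₁ q₂ σ CP F X
      = twiceLaw q₁ q₂ σ (fun i => CP (F (X.get i))) Finset.univ := by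
  rw [twiceSampling, twiceLaw, Finset.powerset_univ]

lemma twiceSampling_perm {X Y : List 𝒳} (h : X.Perm Y) :
    twiceSampling q₁ q₂ σ CP F X = twiceSampling q₁ q₂ σ CP F Y := by
  obtain ⟨e, he⟩ := exists_equiv_of_perm h
  rw [twiceSampling_eq, twiceSampling_eq, ← Finset.map_univ_equiv e, twiceLaw_map]
  congr 1
  ext i
  simp only [Function.comp_apply, Equiv.coe_toEmbedding, he]

/-- This places the smaller dataset in the index type of `x :: X`, so that adding a point becomes an
`insert` of the index `0`. -/
lemma twiceSampling_tail (x : 𝒳) (X : List 𝒳) :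
    twiceSampling q₁ q₂ σ CP F X
      = twiceLaw q₁ q₂ σ (fun i => CP (F ((x :: X).get i)))
          (Finset.univ.map (Fin.succEmb X.length)) := by
  rw [twiceSampling_eq, twiceLaw_map]
  rfl

lemma twiceSampling_cons (x : 𝒳) (X : List 𝒳) :
    twiceSampling q₁ q₂ σ CP F (x :: X)
      = twiceLaw q₁ q₂ σ (fun i => CP (F ((x :: X).get i)))
          (insert (0 : Fin (X.length + 1)) (Finset.univ.map (Fin.succEmb X.length))) := by
  rw [twiceSampling_eq]
  congr 1
  ext i
  refine Fin.cases ?_ (fun j => ?_) i <;> simp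

lemma isRDP_twiceSampling {q₁ q₂ σ : ℝ} {CP : (Fin d → ℝ) → (Fin d → ℝ)} {F : 𝒳 → Fin d → ℝ}
    (hq₁ : q₁ ∈ Set.Icc (0 : ℝ) 1) (hq₂ : q₂ ∈ Set.Icc (0 : ℝ) 1) (hσ : 0 < σ) {n : ℕ} {B : ℝ}
    (hB : 0 < B)
    (h : ∀ z, ∫⁻ x, ENNReal.ofReal (mixRatio (Real.toNNReal (σ ^ 2)) q₁ q₂ (CP z) x ^ (n + 1))
      ∂(Measure.pi fun _ => gaussianReal 0 (Real.toNNReal (σ ^ 2))) ≤ ENNReal.ofReal B) :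
    IsRDP (twiceSampling q₁ q₂ σ CP F) ((n + 1 : ℕ) : ℝ)
      (Real.log B / (((n + 1 : ℕ) : ℝ) - 1)) := by
  have key (x : 𝒳) (X : List 𝒳) := renyiDiv_twiceLaw_insert_le hq₁ hq₂ hσ
    (fun i => CP (F ((x :: X).get i))) (a := (0 : Fin (X.length + 1)))
    (T := Finset.univ.map (Fin.succEmb X.length)) (by simp) hB (h _)
  rintro X X' ⟨x, hx | hx⟩
  · rw [twiceSampling_perm q₁ q₂ σ CP F hx, twiceSampling_cons, twiceSampling_tail _ _ _ _ _ x X]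
    exact (key x X).2
  · rw [twiceSampling_perm q₁ q₂ σ CP F hx, twiceSampling_cons, twiceSampling_tail _ _ _ _ _ x X']
    exact (key x X').1

end Lists

/-! ### Mixed clipping -/

/-- Interpolation between the two norms: `|s l|² = |s l| ^ p * |s l| ^ (2 - p)`, with the second
factor bounded by the sup norm. -/
lemma sum_sq_le_of_mem_mixedBall {d : ℕ} {p c cinf : ℝ} (hp : 0 < p) (hp2 : p ≤ 2) (hc : 0 < c)
    (hcinf : 0 < cinf) {s : Fin d → ℝ} (hs : s ∈ mixedBall d p c cinf) :
    ∑ l, s l ^ 2 ≤ c ^ 2 * (cinf / c) ^ (2 - p) := by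
  obtain ⟨h1, h2⟩ := hs
  have h0 : 0 ≤ ∑ l, |s l| ^ p := Finset.sum_nonneg fun l _ => by positivity
  have h1' : ∑ l, |s l| ^ p ≤ c ^ p := by
    have := Real.rpow_le_rpow (by positivity) h1 hp.le
    rwa [← Real.rpow_mul h0, one_div_mul_cancel hp.ne', Real.rpow_one] at this
  calc ∑ l, s l ^ 2 ≤ ∑ l, |s l| ^ p * cinf ^ (2 - p) := by
        refine Finset.sum_le_sum fun l _ => ?_
        have : s l ^ 2 = |s l| ^ p * |s l| ^ (2 - p) := by
          rw [← Real.rpow_add' (abs_nonneg _) (by norm_num), add_sub_cancel, ← sq_abs]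
          exact (Real.rpow_natCast _ 2).symm
        rw [this]
        exact mul_le_mul_of_nonneg_left
          (Real.rpow_le_rpow (abs_nonneg _) (h2 l) (by linarith)) (by positivity)
    _ ≤ c ^ p * cinf ^ (2 - p) := by
        rw [← Finset.sum_mul]
        exact mul_le_mul_of_nonneg_right h1' (by positivity)
    _ = c ^ 2 * (cinf / c) ^ (2 - p) := by
        have : c ^ 2 = c ^ p * c ^ (2 - p) := by
          rw [← Real.rpow_add hc, add_sub_cancel]
          exact (Real.rpow_natCast _ 2).symm
        rw [this, Real.div_rpow hcinf.le hc.le]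
        have := (Real.rpow_pos_of_pos hc (2 - p)).ne'
        field_simp

/-- The slack `η / α` is scaled so that `j (j - 1) q² ≤ α (α - 1)` turns it into `(α - 1) η`, which
contributes exactly `η` after the logarithm is divided by `α - 1`. -/
lemma prod_binomExp_le {d : ℕ} {v : NNReal} (hv : v ≠ 0) {q : ℝ} (hq : q ∈ Set.Icc (0 : ℝ) 1)
    (s : Fin d → ℝ) {j α : ℕ} (hj : j ≤ α) (hα : 1 ≤ α) {y τ η : ℝ} (hη : 0 ≤ η) (hy : y ≤ 1)
    (hsy : ∀ l, (α : ℝ) ^ 2 * (s l ^ 2 / (2 * v)) ≤ y)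
    (hs : (1 + y) * ∑ l, s l ^ 2 / (2 * v) ≤ τ + η / α) :
    ∏ l, binomExp j q (s l ^ 2 / (2 * v))
      ≤ Real.exp ((j : ℝ) * ((j : ℝ) - 1) * (q ^ 2 * τ)) * Real.exp (((α : ℝ) - 1) * η) := by
  have hα0 : (0 : ℝ) < α := by exact_mod_cast hα
  calc ∏ l, binomExp j q (s l ^ 2 / (2 * v))
      ≤ ∏ l, Real.exp ((j : ℝ) * ((j : ℝ) - 1) * q ^ 2 * ((1 + y) * (s l ^ 2 / (2 * v)))) :=
        Finset.prod_le_prod (fun l _ => (binomExp_pos j hq _).le) fun l _ =>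
          binomExp_le_exp hj hq (by positivity) (hsy l) hy
    _ = Real.exp ((j : ℝ) * ((j : ℝ) - 1) * q ^ 2 * ((1 + y) * ∑ l, s l ^ 2 / (2 * v))) := by
        rw [← Real.exp_sum, Finset.mul_sum, Finset.mul_sum]
    _ ≤ _ := by
        rw [← Real.exp_add]
        refine Real.exp_le_exp.2 ?_
        have hjj := natCast_mul_pred_nonneg j
        have h1 := mul_le_mul_of_nonneg_left hs (mul_nonneg hjj (sq_nonneg q))
        have h2 : (j : ℝ) * ((j : ℝ) - 1) * q ^ 2 ≤ (α : ℝ) * ((α : ℝ) - 1) :=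
          (mul_le_of_le_one_right hjj (pow_le_one₀ hq.1 hq.2)).trans (natCast_mul_pred_le hj)
        have h3 := mul_le_mul_of_nonneg_right h2 (div_nonneg hη hα0.le)
        have h4 : (α : ℝ) * ((α : ℝ) - 1) * (η / α) = ((α : ℝ) - 1) * η := by field_simp
        linarith

lemma lintegral_mixRatio_pow_le {d : ℕ} {v : NNReal} (hv : v ≠ 0) {q₁ q₂ : ℝ}
    (hq₁ : q₁ ∈ Set.Icc (0 : ℝ) 1) (hq₂ : q₂ ∈ Set.Icc (0 : ℝ) 1)
    (s : Fin d → ℝ) {α : ℕ} (hα : 1 ≤ α) {y τ η : ℝ} (hη : 0 ≤ η) (hy : y ≤ 1)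
    (hsy : ∀ l, (α : ℝ) ^ 2 * (s l ^ 2 / (2 * v)) ≤ y)
    (hs : (1 + y) * ∑ l, s l ^ 2 / (2 * v) ≤ τ + η / α) :
    ∫⁻ x, ENNReal.ofReal (mixRatio v q₁ q₂ s x ^ α) ∂(Measure.pi fun _ => gaussianReal 0 v)
      ≤ ENNReal.ofReal (binomExp α q₁ (q₂ ^ 2 * τ) * Real.exp (((α : ℝ) - 1) * η)) := by
  have h1q : 0 ≤ 1 - q₁ := by linarith [hq₁.2]
  have hq0 := hq₁.1
  simp only [mixRatio]
  rw [lintegral_mix_pow _ hq₁ (by fun_prop) fun x => (prodRatio_pos v hq₂ s x).le, binomExp,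
    Finset.sum_mul, ENNReal.ofReal_sum_of_nonneg fun j _ => by positivity]
  refine Finset.sum_le_sum fun j hj => ?_
  rw [lintegral_prodRatio_pow hv hq₂, ← ENNReal.ofReal_mul (by positivity)]
  refine ENNReal.ofReal_le_ofReal ?_
  rw [mul_assoc _ (Real.exp _)]
  exact mul_le_mul_of_nonneg_left (prod_binomExp_le hv hq₂ s
    (Nat.lt_succ_iff.1 (Finset.mem_range.1 hj)) hα hη hy hsy hs) (by positivity)

lemma exists_threshold {p τ η a A : ℝ} (hp : 0 < p) (hp2 : p ≤ 2) (hτ : 0 < τ) (ha : 0 < a)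
    (hη : 0 < η ∨ (η = 0 ∧ p < 2)) :
    ∃ N : ℕ, 1 ≤ N ∧ ∀ k : ℕ, N ≤ k → ∀ r : ℝ, 0 < r → (k : ℝ) * r ^ p = 1 →
      A * r ^ 2 ≤ 1 ∧ (1 + A * r ^ 2) * (τ * r ^ (2 - p)) ≤ τ + η / a := by
  have hr : Filter.Tendsto (fun k : ℕ => (k : ℝ) ^ (-(1 / p))) Filter.atTop (nhds 0) :=
    (tendsto_rpow_neg_atTop (by positivity)).comp tendsto_natCast_atTop_atTop
  have h1 : Filter.Tendsto (fun r : ℝ => A * r ^ 2) (nhds 0) (nhds 0) := by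
    have : Continuous fun r : ℝ => A * r ^ 2 := by fun_prop
    simpa using this.tendsto 0
  have h2 : Filter.Tendsto (fun r : ℝ => (1 + A * r ^ 2) * (τ * r ^ (2 - p))) (nhds 0)
      (nhds (τ * 0 ^ (2 - p))) := by
    have : Filter.Tendsto (fun r : ℝ => r ^ (2 - p)) (nhds 0) (nhds (0 ^ (2 - p))) :=
      (Real.continuousAt_rpow_const 0 _ (Or.inr (by linarith))).tendsto
    simpa using (h1.const_add 1).mul (this.const_mul τ)
  -- The limit is `0` for `p < 2`, leaving room even when `η = 0`. For `p = 2` it is `τ`, as `0 ^ 0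
  -- = 1`, and `η > 0` is needed.
  have hlt : τ * 0 ^ (2 - p) < τ + η / a := by
    rcases hp2.lt_or_eq with hp' | rfl
    · have : 0 ≤ η / a := by
        rcases hη with h | ⟨rfl, _⟩
        · positivity
        · simp
      rw [Real.zero_rpow (by linarith)]
      linarith
    · have : 0 < η / a := div_pos (hη.resolve_right fun h => lt_irrefl _ h.2) ha
      simpa using this
  have hev := ((h1.comp hr).eventually_lt_const one_pos).and ((h2.comp hr).eventually_lt_const hlt)
  obtain ⟨N, hN⟩ := Filter.eventually_atTop.1 hev
  refine ⟨max N 1, le_max_right _ _, fun k hk r hr0 hkr => ?_⟩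
  have hk0 : (0 : ℝ) < k := by exact_mod_cast (le_max_right _ _).trans hk
  have e : r = (k : ℝ) ^ (-(1 / p)) := by
    have : r ^ p = (k : ℝ)⁻¹ := eq_inv_of_mul_eq_one_right hkr
    rw [Real.rpow_neg hk0.le, ← Real.inv_rpow hk0.le, ← this, ← Real.rpow_mul hr0.le,
      mul_one_div_cancel hp.ne', Real.rpow_one]
  have := hN k ((le_max_left _ _).trans hk)
  simp only [Function.comp_apply, ← e] at this
  exact ⟨this.1.le, this.2.le⟩

end TwiceSampling

end

/-! ### The main theorem -/

open TwiceSampling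

theorem corollary2 :
    (∀ (α : ℕ) (p c σ q₁ q₂ η : ℝ), 2 ≤ α → 0 < p → p ≤ 2 → 0 < c → 0 < σ →
      q₁ ∈ Set.Icc (0 : ℝ) 1 → q₂ ∈ Set.Icc (0 : ℝ) 1 → (0 < η ∨ (η = 0 ∧ p < 2)) →
      ∃ N : ℕ, ∀ d₀ d : ℕ, N ≤ d₀ → d₀ ≤ d →
        ∀ (𝒳 : Type u) (F : 𝒳 → Fin d → ℝ) (CP : (Fin d → ℝ) → (Fin d → ℝ)) (cinf : ℝ),
          0 < cinf → (d₀ : ℝ) * cinf ^ p = c ^ p →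
          (∀ v, CP v ∈ TwiceSampling.mixedBall d p c cinf) →
          TwiceSampling.IsRDP (TwiceSampling.twiceSampling q₁ q₂ σ CP F) (α : ℝ)
            (TwiceSampling.epsTwice α q₁ q₂ ((c / (Real.sqrt 2 * σ)) ^ 2) + η)) ∧
    (∃ C : ℝ, 0 < C ∧ ∀ (α : ℕ) (τ : ℝ), 2 ≤ α → 0 < τ →
      ∃ q₀ : ℝ, 0 < q₀ ∧ ∀ q₁ q₂ : ℝ, 0 < q₁ → q₁ ≤ q₀ → 0 < q₂ → q₂ ≤ q₀ →
        TwiceSampling.epsTwice α q₁ q₂ τ ≤ C * ((α : ℝ) * (q₁ * q₂) ^ 2 * τ)) := by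
  constructor
  · intro α p c σ q₁ q₂ η hα hp hp2 hc hσ hq₁ hq₂ hη
    have hα1 : 1 ≤ α := by omega
    have hα0 : (0 : ℝ) < α := by exact_mod_cast hα1
    have hα2 : (0 : ℝ) < (α : ℝ) - 1 := by
      have : (2 : ℝ) ≤ α := by exact_mod_cast hα
      linarith
    have hη0 : 0 ≤ η := hη.elim le_of_lt fun h => h.1.ge
    set τ := (c / (Real.sqrt 2 * σ)) ^ 2 with hτdef
    have hτ : 0 < τ := by positivity
    have hτ' : τ = c ^ 2 / (2 * σ ^ 2) := by
      rw [hτdef, div_pow, mul_pow, Real.sq_sqrt (by norm_num)]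
    -- For `r = cinf / c`, this `A` makes `A * r ^ 2 = α² cinf² / (2σ²)`, the value of `y` that
    -- dominates every coordinate.
    obtain ⟨N, hN1, hN⟩ := exists_threshold (A := (α : ℝ) ^ 2 * τ) hp hp2 hτ hα0 hη
    refine ⟨N, fun d₀ d hd₀ _ 𝒳 F CP cinf hcinf hcc hCP => ?_⟩
    have hr : (d₀ : ℝ) * (cinf / c) ^ p = 1 := by
      rw [Real.div_rpow hcinf.le hc.le, ← mul_div_assoc, hcc,
        div_self (Real.rpow_pos_of_pos hc p).ne']
    obtain ⟨hy, hθ⟩ := hN d₀ hd₀ (cinf / c) (by positivity) hr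
    have hv : Real.toNNReal (σ ^ 2) ≠ 0 := by simpa using hσ.ne'
    have hvσ : ((Real.toNNReal (σ ^ 2) : NNReal) : ℝ) = σ ^ 2 := Real.coe_toNNReal _ (sq_nonneg σ)
    have hB : 0 < binomExp α q₁ (q₂ ^ 2 * τ) * Real.exp (((α : ℝ) - 1) * η) :=
      mul_pos (binomExp_pos α hq₁ _) (Real.exp_pos _)
    have hε : epsTwice α q₁ q₂ τ + η
        = Real.log (binomExp α q₁ (q₂ ^ 2 * τ) * Real.exp (((α : ℝ) - 1) * η)) / ((α : ℝ) - 1) := by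
      rw [epsTwice_eq, Real.log_mul (binomExp_pos α hq₁ _).ne' (Real.exp_pos _).ne', Real.log_exp]
      field_simp
    obtain ⟨n, rfl⟩ : ∃ n, α = n + 1 := ⟨α - 1, by omega⟩
    rw [hε]
    refine isRDP_twiceSampling hq₁ hq₂ hσ hB fun z => ?_
    refine lintegral_mixRatio_pow_le hv hq₁ hq₂ (CP z) hα1 hη0 hy (fun l => ?_) ?_
    · rw [hvσ, mul_assoc, hτ']
      refine mul_le_mul_of_nonneg_left ?_ (sq_nonneg _)
      have : c ^ 2 / (2 * σ ^ 2) * (cinf / c) ^ 2 = cinf ^ 2 / (2 * σ ^ 2) := by field_simp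
      rw [this]
      refine div_le_div_of_nonneg_right ?_ (by positivity)
      exact sq_le_sq' (by linarith [neg_abs_le (CP z l), (hCP z).2 l])
        ((le_abs_self _).trans ((hCP z).2 l))
    · refine le_trans (mul_le_mul_of_nonneg_left ?_ (by positivity)) hθ
      rw [hvσ, ← Finset.sum_div, hτ', div_mul_eq_mul_div]
      exact div_le_div_of_nonneg_right
        (sum_sq_le_of_mem_mixedBall hp hp2 hc hcinf (hCP z)) (by positivity)
  · refine ⟨2, two_pos, fun α τ hα hτ => ?_⟩
    have hα0 : (0 : ℝ) < α := by exact_mod_cast (by omega : 0 < α)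
    -- Both `q₂ ≤ 1` and `q₂ α² τ ≤ 1` hold below this threshold, hence `α² q₂² τ ≤ 1`.
    refine ⟨min 1 (1 / ((α : ℝ) ^ 2 * τ)), by positivity, fun q₁ q₂ h1 h1' h2 h2' => ?_⟩
    refine epsTwice_le hα hτ ⟨h1.le, h1'.trans (min_le_left _ _)⟩ ?_
    have h3 : q₂ * ((α : ℝ) ^ 2 * τ) ≤ 1 :=
      (le_div_iff₀ (by positivity)).1 (h2'.trans (min_le_right _ _))
    have h4 : q₂ ≤ 1 := h2'.trans (min_le_left _ _)
    calc (α : ℝ) ^ 2 * (q₂ ^ 2 * τ) = q₂ * (q₂ * ((α : ℝ) ^ 2 * τ)) := by ring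
      _ ≤ 1 := mul_le_one₀ h4 (by positivity) h3
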